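/- **Problem.** Let $\mathcal X=\{\mathbf x\in\mathbb R^{n_x}_+\times\mathbb Z^{m_x}_+:\mathbf A\mathbf x\ge\mathbf b\}$, $\mathcal U(\mathbf x)=\{\mathbf u\in\mathbb R^{n_u}_+:\mathbf F(\mathbf x)\mathbf u\le\mathbf h+\mathbf G\mathbf x\}$ with an arbitrary matrix-valued function $\mathbf F$, let $\mathbb Y_d\subseteq\mathbb Z^{m_y}_+$ be nonempty and finite, and $$\mathcal Y(\mathbf x,\mathbf u)=\{(\mathbf y_c,\mathbf y_d)\in\mathbb R^{n_y}_+\times\mathbb Y_d:\ \mathbf B_{2,c}\mathbf y_c\ge \mathbf r(\mathbf x,\mathbf u,\mathbf y_d)\},\qquad \mathbf r(\mathbf x,\mathbf u,\mathbf y_d)=\mathbf d-\mathbf B_1\mathbf x-\mathbf E\mathbf u-\mathbf B_{2,d}\mathbf y_d .$$ Consider $$w^*=\inf_{\mathbf x\in\mathcal X}\ \mathbf c_1\mathbf x+\eta_o(\mathbf x),\qquad \eta_o(\mathbf x)=\sup_{\mathbf u\in\mathcal U(\mathbf x)}\ \inf_{(\mathbf y_c,\mathbf y_d)\in\mathcal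 Y(\mathbf x,\mathbf u)}\mathbf c_{2,c}\mathbf y_c+\mathbf c_{2,d}\mathbf y_d .$$ Here $\mathbf x\in\mathcal X$ is feasible if $\mathcal Y(\mathbf x,\mathbf u)\ne\emptyset$ for every $\mathbf u\in\mathcal U(\mathbf x)$, and the problem is infeasible if no $\mathbf x\in\mathcal X$ is feasible. Assume that for every $\mathbf x\in\mathcal X$ the set $\mathcal U(\mathbf x)$ is nonempty and bounded, and that $\mathbf c_1\mathbf x+\mathbf c_{2,c}\mathbf y_c+\mathbf c_{2,d}\mathbf y_d$ is bounded below over all $\mathbf x\in\mathcal X$, $\mathbf u\in\mathcal U(\mathbf x)$, $(\mathbf y_c,\mathbf y_d)\in\mathcal Y(\mathbf x,\mathbf u)$. Relatively complete recourse is not assumed. **Notation.** Let $\Pi=\{\pi\ge\mathbf 0:\mathbf B_{2,c}^\intercal\pi\le\mathbf c_{2,c}^\intercal\}$, let $\mathcal P_\Pi$ be its set of extreme points, $\Pi_f=\{\pi\ge\mathbf 0:\mathbf B_{2,c}^\intercal\pi\le\mathbf 0,\ \mathbf 1^\intercal\pi\le1\}$, and $\mathcal R_\Pi$ the set of nonzero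 extreme points of $\Pi_f$ (the normalized extreme rays). For a finite set $S=\widehat{(\mathbf y_d,\pi)}$ of pairs $(\mathbf y_d,\pi)$ let $\mathcal{OU}(\mathbf x,S)$ be the set of the $\mathbf u$-parts of the optimal solutions of $$\max\{\hat\eta:\ \mathbf u\in\mathcal U(\mathbf x),\ \hat\eta\le\mathbf c_{2,d}\mathbf y_d+\mathbf r(\mathbf x,\mathbf u,\mathbf y_d)^\intercal\pi\ \ \forall(\mathbf y_d,\pi)\in S\}.$$ Let $\tilde{\mathcal Y}(\mathbf x,\mathbf u)$ be the set of $(\mathbf y_c,\mathbf y_d,\tilde y)$ with $\mathbf y_c\ge\mathbf 0$, $\mathbf y_d\in\mathbb Y_d$, $\tilde y\ge0$, $\mathbf B_{2,c}\mathbf y_c+\mathbf 1\tilde y\ge\mathbf r(\mathbf x,\mathbf u,\mathbf y_d)$; let $g_{\mathbf y_d}(\mathbf x,\mathbf u)$ be the least such $\tilde y$ for fixed $\mathbf y_d$, and $f_{\mathbf y_d}(\mathbf x,\mathbf u)\in(-\infty,+\infty]$ the optimal recourse cost for fixed $\mathbf y_d$. **Nested parametric C&CG** (all tolerances $0$; every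 problem that is solved may return any of its optimal solutions). *Outer procedure.* Start with $LB=-\infty$, $UB=+\infty$ and a (possibly empty) collection $\mathcal S$ of nonempty finite sets $S\subseteq\mathbb Y_d\times(\mathcal P_\Pi\cup\mathcal R_\Pi)$. In each outer iteration solve the master problem $\mathbf{OMP}$: minimize $\mathbf c_1\mathbf x+\eta$ over $\mathbf x\in\mathcal X$, $\eta\in\mathbb R$ such that for every $S\in\mathcal S$ there are $\mathbf u\in\mathcal{OU}(\mathbf x,S)$ and $(\mathbf y_c,\mathbf y_d)\in\mathcal Y(\mathbf x,\mathbf u)$ with $\eta\ge\mathbf c_{2,c}\mathbf y_c+\mathbf c_{2,d}\mathbf y_d$. If it is infeasible, report infeasibility. Otherwise let $LB$ be its value and $\mathbf x^*$ the first-stage part of an optimal solution (if $\mathcal S=\emptyset$: $LB=-\infty$ and any $\mathbf x^*\in\mathcal X$). Call ISF at $\mathbf x^*$. If it returns a set $S$, add $S$ to $\mathcal S$. Otherwise call ISO at $\mathbf x^*$, add the set $S$ it returns to $\mathcal S$, let $UB\leftarrow\min\{UB,\mathbf c_1\mathbf x^*+\eta_o\}$ with the value $\eta_o$ it returns, and let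 $\mathbf x^*$ be the incumbent if $\mathbf c_1\mathbf x^*+\eta_o$ is at most the old $UB$. If $UB\le LB$, terminate and return the incumbent and $UB$; otherwise start the next outer iteration. *ISF (feasibility).* Start with any nonempty $\hat{\mathbb Y}\subseteq\mathbb Y_d$. Phase I: solve $\mathbf{IMP}_f$: $v=\max_{\mathbf u\in\mathcal U(\mathbf x^*)}\min_{\mathbf y_d\in\hat{\mathbb Y}}g_{\mathbf y_d}(\mathbf x^*,\mathbf u)$, obtaining an optimal $\mathbf u^*$ and, for $\mathbf y_d\in\hat{\mathbb Y}$, extreme points $\pi^{\mathbf y_d}$ of $\Pi_f$ with $v\le\mathbf r(\mathbf x^*,\mathbf u^*,\mathbf y_d)^\intercal\pi^{\mathbf y_d}$. If $v=0$, declare $\mathbf x^*$ feasible. Otherwise minimize $\tilde y$ over $\tilde{\mathcal Y}(\mathbf x^*,\mathbf u^*)$; if the value is $0$, add the optimal $\mathbf y_d^*$ to $\hat{\mathbb Y}$ and repeat Phase I; if it is positive, put $S=\{(\mathbf y_d,\pi^{\mathbf y_d}):\mathbf y_d\in\hat{\mathbb Y}\}$ and go to Phase II. Phase II (correction): minimize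 $\tilde y$ over $\mathbf u\in\mathcal{OU}(\mathbf x^*,S)$, $(\mathbf y_c,\mathbf y_d,\tilde y)\in\tilde{\mathcal Y}(\mathbf x^*,\mathbf u)$. If the value is positive, return $S$. If it is $0$, add to $S$ the pair $(\mathbf y_d^*,\pi^*)$, where $(\mathbf u^*,\mathbf y_d^*)$ comes from the optimal solution and $\pi^*$ is an extreme point of $\Pi_f$ maximizing $\mathbf r(\mathbf x^*,\mathbf u^*,\mathbf y_d^*)^\intercal\pi$ over $\Pi_f$, and repeat Phase II. *ISO (optimality).* Start with any $\hat{\mathbb Y}\subseteq\mathbb Y_d$ and $\ell=-\infty$. Phase I: solve $\mathbf{IMP}_o$: $v=\max_{\mathbf u\in\mathcal U(\mathbf x^*)}\min_{\mathbf y_d\in\hat{\mathbb Y}}f_{\mathbf y_d}(\mathbf x^*,\mathbf u)\in(-\infty,+\infty]$, obtaining an optimal $\mathbf u^*$ and, for $\mathbf y_d\in\hat{\mathbb Y}$, either $\pi^{\mathbf y_d}\in\mathcal P_\Pi$ with $v\le\mathbf c_{2,d}\mathbf y_d+\mathbf r(\mathbf x^*,\mathbf u^*,\mathbf y_d)^\intercal\pi^{\mathbf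 y_d}$ or $\pi^{\mathbf y_d}\in\mathcal R_\Pi$ with $\mathbf r(\mathbf x^*,\mathbf u^*,\mathbf y_d)^\intercal\pi^{\mathbf y_d}>0$. Solve the recourse problem at $(\mathbf x^*,\mathbf u^*)$ and let $\ell\leftarrow\max\{\ell,\text{its value}\}$. If $v>\ell$, add its optimal $\mathbf y^*_d$ to $\hat{\mathbb Y}$ and repeat Phase I. Otherwise put $S=\{(\mathbf y_d,\pi^{\mathbf y_d}):\mathbf y_d\in\hat{\mathbb Y}\}$ and go to Phase II. Phase II (correction): minimize $\mathbf c_{2,c}\mathbf y_c+\mathbf c_{2,d}\mathbf y_d$ over $\mathbf u\in\mathcal{OU}(\mathbf x^*,S)$, $(\mathbf y_c,\mathbf y_d)\in\mathcal Y(\mathbf x^*,\mathbf u)$. If the value is less than $\ell$, add to $S$ the pair $(\mathbf y^*_d,\pi^*)$, where $(\mathbf u^*,\mathbf y_d^*)$ comes from the optimal solution and $\pi^*\in\mathcal P_\Pi$ maximizes $\mathbf r(\mathbf x^*,\mathbf u^*,\mathbf y_d^*)^\intercal\pi$ over $\Pi$, and repeat Phase II. Otherwise return $S$ and $\eta_o=v$.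 **Theorem.** Every execution of this algorithm has the following properties. 1. It never regenerates a set $S$ unless it terminates: ISF never returns a set that is already in $\mathcal S$, and if ISO returns a set that is already in $\mathcal S$, then the algorithm terminates in that outer iteration. 2. Upon termination, either it has reported infeasibility and the two-stage problem is infeasible, or it has returned a feasible first-stage decision $\mathbf x$ and a real value $UB$ with $\mathbf c_1\mathbf x+\eta_o(\mathbf x)=UB=w^*$, so that $\mathbf x$ is an exact optimal solution. 3. The number of outer iterations is finite, and bounded by a number that depends on the data of the problem only. An execution has infinitely many steps only if from some point on it stays in the correction phase (Phase II) of a single call of ISF or ISO. 4. An execution that cannot be continued has terminated, unless it has arrived at an outer master problem $\mathbf{OMP}$ that is feasible but has no optimal solution, or at an inner master problem $\mathbf{IMP}_o$ whose supremum is not attained. -/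

import Mathlib

open scoped Matrix

noncomputable section

namespace NestedCCG

/-- Data of a two-stage robust optimization problem with a polyhedral decision-dependent uncertainty
set and a mixed integer recourse problem. The first-stage vector has `nx` continuous and `mx` integer
components, the scenario has `nu` continuous components, the recourse decision has `ny` continuous
and `my` integer components; `ka`, `ku`, `ky` are the numbers of rows of the three constraint
systems. -/
structure TwoStageRO (nx mx nu ny my ka ku ky : ℕ) where
  /-- first-stage cost -/
  c₁ : Fin nx ⊕ Fin mx → ℝ
  A : Matrix (Fin ka) (Fin nx ⊕ Fin mx) ℝ
  b : Fin ka → ℝ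
  /-- left-hand-side decision dependence: an arbitrary matrix-valued function of `x` -/
  F : (Fin nx ⊕ Fin mx → ℝ) → Matrix (Fin ku) (Fin nu) ℝ
  h : Fin ku → ℝ
  G : Matrix (Fin ku) (Fin nx ⊕ Fin mx) ℝ
  /-- recourse costs of the continuous and of the integer part -/
  c₂c : Fin ny → ℝ
  c₂d : Fin my → ℝ
  B₁ : Matrix (Fin ky) (Fin nx ⊕ Fin mx) ℝ
  B₂c : Matrix (Fin ky) (Fin ny) ℝ
  B₂d : Matrix (Fin ky) (Fin my) ℝ
  E : Matrix (Fin ky) (Fin nu) ℝ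
  d : Fin ky → ℝ
  /-- the bounded (that is, finite) set of nonnegative integer recourse decisions -/
  Yd : Finset (Fin my → ℕ)

/-- First-stage decisions. -/
abbrev XVec (nx mx : ℕ) := Fin nx ⊕ Fin mx → ℝ

/-- A finite set of pairs `(y_d, π)`; each inner subroutine returns one such set. -/
abbrev PairSet (my ky : ℕ) := Finset ((Fin my → ℕ) × (Fin ky → ℝ))

/-- Data kept by the outer procedure: the sets of pairs collected so far, the two bounds, and the
incumbent (a first-stage decision whose worst-case cost is `ub`). -/
structure OuterState (nx mx my ky : ℕ) where
  pool : Set (PairSet my ky)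
  lb : EReal
  ub : EReal
  inc : Option (XVec nx mx)

/-- Control states of the nested algorithm. -/
inductive Config (nx mx my ky : ℕ) where
  /-- about to solve the outer master problem -/
  | outer (st : OuterState nx mx my ky)
  /-- feasibility subroutine at `x`, first phase -/
  | isfPhase1 (st : OuterState nx mx my ky) (x : XVec nx mx) (Y : Finset (Fin my → ℕ))
  /-- feasibility subroutine at `x`, correction phase -/
  | isfPhase2 (st : OuterState nx mx my ky) (x : XVec nx mx) (S : PairSet my ky)
  /-- the feasibility subroutine has found `x` infeasible and returns `S` -/
  | isfReturn (st : OuterState nx mx my ky) (x : XVec nx mx) (S : PairSet my ky)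
  /-- optimality subroutine at `x`, first phase, with its own lower bound `l` -/
  | isoPhase1 (st : OuterState nx mx my ky) (x : XVec nx mx) (Y : Finset (Fin my → ℕ)) (l : EReal)
  /-- optimality subroutine at `x`, correction phase, with its own bounds `l` and `v` -/
  | isoPhase2 (st : OuterState nx mx my ky) (x : XVec nx mx) (S : PairSet my ky) (l v : EReal)
  /-- the optimality subroutine returns `S` and the worst-case recourse cost `v` of `x` -/
  | isoReturn (st : OuterState nx mx my ky) (x : XVec nx mx) (S : PairSet my ky) (v : EReal)
  /-- the algorithm has reported infeasibility -/
  | infeasible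
  /-- the algorithm has returned the first-stage decision `x` and the value `v` -/
  | done (x : XVec nx mx) (v : EReal)

namespace TwoStageRO

variable {nx mx nu ny my ka ku ky : ℕ} (D : TwoStageRO nx mx nu ny my ka ku ky)

/-! The two-stage problem -/

/-- The real vector of an integer recourse decision. -/
def castVec (y : Fin my → ℕ) : Fin my → ℝ := fun j => (y j : ℝ)

/-- The mixed integer first-stage feasible set. -/
def X : Set (XVec nx mx) :=
  {x | 0 ≤ x ∧ (∀ j : Fin mx, ∃ k : ℕ, x (Sum.inr j) = k) ∧ D.b ≤ D.A *ᵥ x}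

/-- The decision-dependent uncertainty set. -/
def U (x : XVec nx mx) : Set (Fin nu → ℝ) :=
  {u | 0 ≤ u ∧ D.F x *ᵥ u ≤ D.h + D.G *ᵥ x}

/-- `d - B₁ x - E u - B₂d y_d`. -/
def residual (x : XVec nx mx) (u : Fin nu → ℝ) (yd : Fin my → ℕ) : Fin ky → ℝ :=
  D.d - D.B₁ *ᵥ x - D.E *ᵥ u - D.B₂d *ᵥ castVec yd

/-- The mixed integer recourse feasible set. -/
def Y (x : XVec nx mx) (u : Fin nu → ℝ) : Set ((Fin ny → ℝ) × (Fin my → ℕ)) :=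
  {y | 0 ≤ y.1 ∧ y.2 ∈ D.Yd ∧ D.residual x u y.2 ≤ D.B₂c *ᵥ y.1}

/-- Recourse cost. -/
def cost (y : (Fin ny → ℝ) × (Fin my → ℕ)) : ℝ := D.c₂c ⬝ᵥ y.1 + D.c₂d ⬝ᵥ castVec y.2

/-- Optimal value of the recourse problem (`⊤` if it is infeasible). -/
def recourseValue (x : XVec nx mx) (u : Fin nu → ℝ) : EReal :=
  ⨅ y ∈ D.Y x u, (D.cost y : EReal)

/-- Worst-case recourse cost of `x`. -/
def worstCase (x : XVec nx mx) : EReal := ⨆ u ∈ D.U x, D.recourseValue x u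

/-- Objective of the two-stage problem. -/
def objective (x : XVec nx mx) : EReal := ((D.c₁ ⬝ᵥ x : ℝ) : EReal) + D.worstCase x

/-- Optimal value of the two-stage problem. -/
def optimalValue : EReal := ⨅ x ∈ D.X, D.objective x

/-- `x` is feasible: the recourse problem is feasible in every scenario. -/
def IsFeasible (x : XVec nx mx) : Prop := x ∈ D.X ∧ ∀ u ∈ D.U x, (D.Y x u).Nonempty

/-- `x` is an optimal first-stage decision. -/
def IsOptimal (x : XVec nx mx) : Prop :=
  D.IsFeasible x ∧ ∀ x' ∈ D.X, D.objective x ≤ D.objective x'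

/-! Standing assumptions -/

/-- The uncertainty sets are nonempty. -/
def AssumptionA1 : Prop := ∀ x ∈ D.X, (D.U x).Nonempty

/-- The uncertainty sets are bounded. -/
def AssumptionA2 : Prop := ∀ x ∈ D.X, Bornology.IsBounded (D.U x)

/-- The monolithic relaxation, minimizing jointly over `x`, `u` and `y`, is bounded below. -/
def AssumptionA3 : Prop :=
  ∃ w : ℝ, ∀ x ∈ D.X, ∀ u ∈ D.U x, ∀ y ∈ D.Y x u, w ≤ D.c₁ ⬝ᵥ x + D.cost y

/-! Dual polyhedra, extreme points and extreme rays -/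

/-- Dual feasible set of the continuous part of the recourse problem. -/
def dualSet : Set (Fin ky → ℝ) := {p | 0 ≤ p ∧ D.B₂cᵀ *ᵥ p ≤ D.c₂c}

/-- Dual feasible set of the feasibility version of the continuous recourse problem. -/
def dualSetF : Set (Fin ky → ℝ) := {p | 0 ≤ p ∧ D.B₂cᵀ *ᵥ p ≤ 0 ∧ ∑ i, p i ≤ 1}

/-- Extreme points of the dual feasible set. -/
def points : Set (Fin ky → ℝ) := Set.extremePoints ℝ D.dualSet

/-- Extreme rays of the dual feasible set, normalized to have coordinate sum one: they are the
nonzero extreme points of `dualSetF`. -/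
def rays : Set (Fin ky → ℝ) := Set.extremePoints ℝ D.dualSetF \ {0}

/-! The linear program `LP(x, S)` and its optimal solution set -/

/-- `c₂d y_d + (d - B₁ x - E u - B₂d y_d)ᵀ π` for a pair `p = (y_d, π)`. -/
def term (x : XVec nx mx) (u : Fin nu → ℝ) (p : (Fin my → ℕ) × (Fin ky → ℝ)) : ℝ :=
  D.c₂d ⬝ᵥ castVec p.1 + D.residual x u p.1 ⬝ᵥ p.2

/-- Optimal solution set, projected on the scenario `u`, of the linear program
`max { e : u ∈ U(x), e ≤ term x u p for all p ∈ S }`. -/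
def OU (x : XVec nx mx) (S : PairSet my ky) : Set (Fin nu → ℝ) :=
  {u | u ∈ D.U x ∧ ∃ e : ℝ, (∀ p ∈ S, e ≤ D.term x u p) ∧
    ∀ u' ∈ D.U x, ∀ e' : ℝ, (∀ p ∈ S, e' ≤ D.term x u' p) → e' ≤ e}

/-! Problems of the feasibility subroutine -/

/-- Recourse feasible set with an artificial variable; a point is `((y_c, y_d), t)`. -/
def YTilde (x : XVec nx mx) (u : Fin nu → ℝ) : Set (((Fin ny → ℝ) × (Fin my → ℕ)) × ℝ) :=
  {z | 0 ≤ z.1.1 ∧ z.1.2 ∈ D.Yd ∧ 0 ≤ z.2 ∧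
    D.residual x u z.1.2 ≤ D.B₂c *ᵥ z.1.1 + fun _ => z.2}

/-- Least value of the artificial variable for a fixed integer recourse decision. -/
def violation (x : XVec nx mx) (u : Fin nu → ℝ) (yd : Fin my → ℕ) : EReal :=
  ⨅ (yc : Fin ny → ℝ) (t : ℝ)
    (_ : 0 ≤ yc ∧ 0 ≤ t ∧ D.residual x u yd ≤ D.B₂c *ᵥ yc + fun _ => t), (t : EReal)

/-- Optimal value of the inner master problem for feasibility. -/
def impfValue (x : XVec nx mx) (Y : Finset (Fin my → ℕ)) : EReal :=
  ⨆ u ∈ D.U x, ⨅ y ∈ Y, D.violation x u y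

/-- `(u, π)` is an optimal solution of the inner master problem for feasibility: the scenario `u`
attains the value, and each `π y` is an extreme dual point showing that the constraint of `y`
holds. -/
def IsIMPf (x : XVec nx mx) (Y : Finset (Fin my → ℕ)) (u : Fin nu → ℝ)
    (π : (Fin my → ℕ) → Fin ky → ℝ) : Prop :=
  u ∈ D.U x ∧ (⨅ y ∈ Y, D.violation x u y) = D.impfValue x Y ∧
    ∀ y ∈ Y, π y ∈ Set.extremePoints ℝ D.dualSetF ∧
      D.impfValue x Y ≤ ((D.residual x u y ⬝ᵥ π y : ℝ) : EReal)

/-- `z` is an optimal solution of the inner subproblem for feasibility. -/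
def IsISPf (x : XVec nx mx) (u : Fin nu → ℝ) (z : ((Fin ny → ℝ) × (Fin my → ℕ)) × ℝ) : Prop :=
  z ∈ D.YTilde x u ∧ ∀ z' ∈ D.YTilde x u, z.2 ≤ z'.2

/-- `(u, z)` is an optimal solution of the correction problem for feasibility. -/
def IsICPf (x : XVec nx mx) (S : PairSet my ky) (u : Fin nu → ℝ)
    (z : ((Fin ny → ℝ) × (Fin my → ℕ)) × ℝ) : Prop :=
  u ∈ D.OU x S ∧ z ∈ D.YTilde x u ∧ ∀ u' ∈ D.OU x S, ∀ z' ∈ D.YTilde x u', z.2 ≤ z'.2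

/-- `p` is an extreme optimal solution of the dual of the feasibility recourse problem. -/
def IsDualf (x : XVec nx mx) (u : Fin nu → ℝ) (yd : Fin my → ℕ) (p : Fin ky → ℝ) : Prop :=
  p ∈ Set.extremePoints ℝ D.dualSetF ∧
    ∀ q ∈ D.dualSetF, D.residual x u yd ⬝ᵥ q ≤ D.residual x u yd ⬝ᵥ p

/-! Problems of the optimality subroutine -/

/-- Optimal recourse cost for a fixed integer recourse decision (`⊤` if infeasible). -/
def costLP (x : XVec nx mx) (u : Fin nu → ℝ) (yd : Fin my → ℕ) : EReal :=
  ⨅ (yc : Fin ny → ℝ) (_ : 0 ≤ yc ∧ D.residual x u yd ≤ D.B₂c *ᵥ yc), (D.cost (yc, yd) : EReal)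

/-- Optimal value of the inner master problem for optimality. -/
def impoValue (x : XVec nx mx) (Y : Finset (Fin my → ℕ)) : EReal :=
  ⨆ u ∈ D.U x, ⨅ y ∈ Y, D.costLP x u y

/-- The scenario `u` attains the value of the inner master problem for optimality. -/
def AttainsIMPo (x : XVec nx mx) (Y : Finset (Fin my → ℕ)) (u : Fin nu → ℝ) : Prop :=
  u ∈ D.U x ∧ (⨅ y ∈ Y, D.costLP x u y) = D.impoValue x Y

/-- `(u, π)` is an optimal solution of the inner master problem for optimality: `u` attains the
value, and each `π y` shows that the constraint of `y` holds, either as an extreme dual point, or as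
an extreme ray along which the dual of the continuous recourse problem is unbounded. -/
def IsIMPo (x : XVec nx mx) (Y : Finset (Fin my → ℕ)) (u : Fin nu → ℝ)
    (π : (Fin my → ℕ) → Fin ky → ℝ) : Prop :=
  D.AttainsIMPo x Y u ∧
    ∀ y ∈ Y, (π y ∈ D.points ∧ D.impoValue x Y ≤ (D.term x u (y, π y) : EReal)) ∨
      (π y ∈ D.rays ∧ 0 < D.residual x u y ⬝ᵥ π y)

/-- `y` is an optimal solution of the inner subproblem for optimality. -/
def IsISPo (x : XVec nx mx) (u : Fin nu → ℝ) (y : (Fin ny → ℝ) × (Fin my → ℕ)) : Prop :=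
  y ∈ D.Y x u ∧ ∀ y' ∈ D.Y x u, D.cost y ≤ D.cost y'

/-- `(u, y)` is an optimal solution of the correction problem for optimality. -/
def IsICPo (x : XVec nx mx) (S : PairSet my ky) (u : Fin nu → ℝ)
    (y : (Fin ny → ℝ) × (Fin my → ℕ)) : Prop :=
  u ∈ D.OU x S ∧ y ∈ D.Y x u ∧ ∀ u' ∈ D.OU x S, ∀ y' ∈ D.Y x u', D.cost y ≤ D.cost y'

/-- `p` is an extreme optimal solution of the dual of the continuous recourse problem. -/
def IsDualo (x : XVec nx mx) (u : Fin nu → ℝ) (yd : Fin my → ℕ) (p : Fin ky → ℝ) : Prop :=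
  p ∈ D.points ∧ ∀ q ∈ D.dualSet, D.residual x u yd ⬝ᵥ q ≤ D.residual x u yd ⬝ᵥ p

/-! The outer master problem -/

/-- `(x, e)` is feasible in the outer master problem: every collected `S` contributes a replicate of
the recourse problem at some scenario of `OU x S`. -/
def OMPFeasible (pool : Set (PairSet my ky)) (x : XVec nx mx) (e : ℝ) : Prop :=
  x ∈ D.X ∧ ∀ S ∈ pool, ∃ u ∈ D.OU x S, ∃ y ∈ D.Y x u, D.cost y ≤ e

/-- `x` is the first-stage part of an optimal solution, and `w` the optimal value, of the outer
master problem. With no cutting set at all the problem is unbounded along `e`; then `w = -∞` and `x`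
is any point of the first-stage feasible set. -/
def IsOMPSolution (pool : Set (PairSet my ky)) (x : XVec nx mx) (w : EReal) : Prop :=
  (∃ e : ℝ, D.OMPFeasible pool x e ∧ w = ((D.c₁ ⬝ᵥ x + e : ℝ) : EReal) ∧
    ∀ x' e', D.OMPFeasible pool x' e' → D.c₁ ⬝ᵥ x + e ≤ D.c₁ ⬝ᵥ x' + e') ∨
  (pool = ∅ ∧ x ∈ D.X ∧ w = ⊥)

/-! The algorithm, with all tolerances equal to zero -/

/-- The set of pairs built from the integer decisions in `Y` and their dual solutions. -/
def pairs (Y : Finset (Fin my → ℕ)) (π : (Fin my → ℕ) → Fin ky → ℝ) : PairSet my ky :=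
  Y.image fun y => (y, π y)

open Classical in
/-- Update after the optimality subroutine: store `S`, update the upper bound and the incumbent. -/
def updateOpt (st : OuterState nx mx my ky) (x : XVec nx mx) (S : PairSet my ky) (v : EReal) :
    OuterState nx mx my ky where
  pool := insert S st.pool
  lb := st.lb
  ub := min st.ub (((D.c₁ ⬝ᵥ x : ℝ) : EReal) + v)
  inc := if ((D.c₁ ⬝ᵥ x : ℝ) : EReal) + v ≤ st.ub then some x else st.inc

/-- Update after the feasibility subroutine: store `S`. -/
def updateFeas (st : OuterState nx mx my ky) (S : PairSet my ky) : OuterState nx mx my ky :=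
  { st with pool := insert S st.pool }

/-- One elementary step of the nested algorithm. Whenever a problem has several optimal solutions,
any of them may be used; the inner subroutines may be started from any set of integer recourse
decisions, which is nonempty in the case of the feasibility subroutine. -/
inductive Step : Config nx mx my ky → Config nx mx my ky → Prop
  /-- the outer master problem is infeasible -/
  | outer_infeasible (st) :
      (¬ ∃ x e, D.OMPFeasible st.pool x e) → Step (.outer st) .infeasible
  /-- the outer master problem is solved, and the feasibility subroutine is called -/
  | outer_solve (st x w Y) :
      D.IsOMPSolution st.pool x w → Y ⊆ D.Yd → Y.Nonempty →
      Step (.outer st) (.isfPhase1 { st with lb := w } x Y)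
  /-- `x` is found feasible, and the optimality subroutine is called -/
  | isf_feasible (st x Y u π Y₀) :
      D.IsIMPf x Y u π → D.impfValue x Y = 0 → Y₀ ⊆ D.Yd →
      Step (.isfPhase1 st x Y) (.isoPhase1 st x Y₀ ⊥)
  /-- the scenario `u` is feasible after all: enlarge `Y` -/
  | isf_expand (st x Y u π z) :
      D.IsIMPf x Y u π → D.impfValue x Y ≠ 0 → D.IsISPf x u z → z.2 = 0 →
      Step (.isfPhase1 st x Y) (.isfPhase1 st x (insert z.1.2 Y))
  /-- the scenario `u` is infeasible: go to the correction phase -/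
  | isf_phase2 (st x Y u π z) :
      D.IsIMPf x Y u π → D.impfValue x Y ≠ 0 → D.IsISPf x u z → 0 < z.2 →
      Step (.isfPhase1 st x Y) (.isfPhase2 st x (pairs Y π))
  /-- the correction problem has value zero: enlarge `S` -/
  | isf_correct (st x S u z p) :
      D.IsICPf x S u z → z.2 = 0 → D.IsDualf x u z.1.2 p →
      Step (.isfPhase2 st x S) (.isfPhase2 st x (insert (z.1.2, p) S))
  /-- the correction problem has a positive value: return `S` -/
  | isf_return (st x S u z) :
      D.IsICPf x S u z → 0 < z.2 → Step (.isfPhase2 st x S) (.isfReturn st x S)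
  /-- the bounds of the optimality subroutine differ: enlarge `Y` -/
  | iso_expand (st x Y l u π y) :
      D.IsIMPo x Y u π → D.IsISPo x u y → ¬ D.impoValue x Y ≤ max l (D.cost y : EReal) →
      Step (.isoPhase1 st x Y l) (.isoPhase1 st x (insert y.2 Y) (max l (D.cost y : EReal)))
  /-- the bounds of the optimality subroutine agree: go to the correction phase -/
  | iso_phase2 (st x Y l u π y) :
      D.IsIMPo x Y u π → D.IsISPo x u y → D.impoValue x Y ≤ max l (D.cost y : EReal) →
      Step (.isoPhase1 st x Y l)
        (.isoPhase2 st x (pairs Y π) (max l (D.cost y : EReal)) (D.impoValue x Y))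
  /-- the correction problem has a value below the lower bound: enlarge `S` -/
  | iso_correct (st x S l v u y p) :
      D.IsICPo x S u y → (D.cost y : EReal) < l → D.IsDualo x u y.2 p →
      Step (.isoPhase2 st x S l v) (.isoPhase2 st x (insert (y.2, p) S) l v)
  /-- the correction problem reaches the lower bound: return `S` and the upper bound -/
  | iso_return (st x S l v u y) :
      D.IsICPo x S u y → ¬ (D.cost y : EReal) < l →
      Step (.isoPhase2 st x S l v) (.isoReturn st x S v)
  /-- outer stopping test after the feasibility subroutine -/
  | feas_stop (st x S x') :
      (updateFeas st S).ub ≤ (updateFeas st S).lb → (updateFeas st S).inc = some x' →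
      Step (.isfReturn st x S) (.done x' (updateFeas st S).ub)
  | feas_continue (st x S) :
      ¬ (updateFeas st S).ub ≤ (updateFeas st S).lb →
      Step (.isfReturn st x S) (.outer (updateFeas st S))
  /-- outer stopping test after the optimality subroutine -/
  | opt_stop (st x S v x') :
      (D.updateOpt st x S v).ub ≤ (D.updateOpt st x S v).lb →
      (D.updateOpt st x S v).inc = some x' →
      Step (.isoReturn st x S v) (.done x' (D.updateOpt st x S v).ub)
  | opt_continue (st x S v) :
      ¬ (D.updateOpt st x S v).ub ≤ (D.updateOpt st x S v).lb →
      Step (.isoReturn st x S v) (.outer (D.updateOpt st x S v))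

/-- Initial states: the bounds are infinite, there is no incumbent, and the pool (which may be empty)
consists of nonempty sets of pairs of an integer recourse decision and an extreme point or ray. -/
def IsInitial (st : OuterState nx mx my ky) : Prop :=
  st.lb = ⊥ ∧ st.ub = ⊤ ∧ st.inc = none ∧
    ∀ S ∈ st.pool, S.Nonempty ∧ ∀ p ∈ S, p.1 ∈ D.Yd ∧ p.2 ∈ D.points ∪ D.rays

/-- `Execution st₀ k c`: some execution started at `st₀` reaches `c` in its `k`-th outer iteration,
that is, after leaving the outer master problem `k` times. -/
inductive Execution (st₀ : OuterState nx mx my ky) : ℕ → Config nx mx my ky → Prop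
  | start : Execution st₀ 0 (.outer st₀)
  | outer (k st c') : Execution st₀ k (.outer st) → D.Step (.outer st) c' →
      Execution st₀ (k + 1) c'
  | inner (k c c') : Execution st₀ k c → (∀ st, c ≠ .outer st) → D.Step c c' →
      Execution st₀ k c'

end TwoStageRO

end NestedCCG

end

/-! The outer master problem is a relaxation whatever pairs `S` contains: for nonempty `S`,
compactness makes `OU x S` a nonempty subset of `U x`, so a feasible `x` with finite worst-case cost
satisfies the constraint of `S` at that cost. Hence `lb` is a lower bound for every objective value
(`IsOMPSolution.le_objective`), and a feasible two-stage problem never has an infeasible master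
problem (`IsFeasible.exists_ompFeasible`). The first phase of the optimality subroutine squeezes the
worst-case cost between its two bounds, so `ub` is the exact objective value of the incumbent, and
`ub ≤ lb` proves optimality.

The correction phases make a returned `S` sharp at the current `x`: every scenario of `OU x S` is
infeasible, or costs at least the worst case of `x`. If `S` had been in the pool, the master
solution would supply a scenario of `OU x S` with a recourse decision of cost at most `lb - c₁ x`.
This is impossible after the feasibility subroutine (`InnerInv.notMem_pool`), and after the
optimality subroutine it forces `ub ≤ lb` (`ub_updateOpt_le_lb`). So every outer iteration that does
not terminate collects a new set, and there are finitely many candidates because polyhedra have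
finitely many extreme points.

Inside an iteration, each repetition of a first phase adds a new integer decision, since a repeated
one would already have closed the gap. A natural number `rank` therefore drops at every step except
corrections. Finally, strong duality gives optimal dual solutions at extreme points, and shows that
for a fixed integer decision the violation and, where finite, the cost are maxima of finitely many
affine functions of the scenario; compactness then solves every subproblem except the two named in
the theorem. -/

noncomputable section

namespace NestedCCG

/-! Linear programming over the reals -/

/-- The homogeneous Farkas lemma. -/
theorem exists_nonneg_eq_sum_of_forall_nonpos {W ι : Type*} [AddCommGroup W] [Module ℝ W]
    (s : Finset ι) (f : ι → W →ₗ[ℝ] ℝ) (g : W →ₗ[ℝ] ℝ)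
    (h : ∀ x, (∀ i ∈ s, f i x ≤ 0) → g x ≤ 0) :
    ∃ l : ι → ℝ, 0 ≤ l ∧ ∀ x, g x = ∑ i ∈ s, l i * f i x := by
  classical
  induction s using Finset.induction_on generalizing f g with
  | empty =>
    refine ⟨0, le_rfl, fun x => ?_⟩
    have h1 := h x (by simp)
    have h2 := h (-x) (by simp)
    rw [map_neg] at h2
    simp only [Finset.sum_empty]
    linarith
  | insert a s ha ih =>
    by_cases hs : ∀ x, (∀ i ∈ s, f i x ≤ 0) → g x ≤ 0
    · obtain ⟨l, hl, hg⟩ := ih f g hs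
      refine ⟨Function.update l a 0, ?_, fun x => ?_⟩
      · intro i
        by_cases hi : i = a
        · subst hi; simp
        · simpa [hi] using hl i
      · rw [Finset.sum_insert ha, hg x]
        simp only [Function.update_self, zero_mul, zero_add]
        refine Finset.sum_congr rfl fun i hi => ?_
        rw [Function.update_of_ne (ne_of_mem_of_not_mem hi ha)]
    · push Not at hs
      obtain ⟨x₀, hx₀, hg₀⟩ := hs
      have hfa : 0 < f a x₀ := by
        by_contra hc
        push Not at hc
        exact absurd (h x₀ (by simpa [Finset.forall_mem_insert] using ⟨hc, hx₀⟩)) (not_le.2 hg₀)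
      -- Eliminate `f a`: each functional is composed with the projection onto its kernel along
      -- `x₀`. Undoing this gives `f a` the coefficient `(g x₀ - ∑ l i * f i x₀) / f a x₀`,
      -- nonnegative because `g x₀ > 0` and every `f i x₀ ≤ 0`.
      obtain ⟨l, hl, hg⟩ := ih (fun i => f i - (f i x₀ / f a x₀) • f a)
        (g - (g x₀ / f a x₀) • f a) (by
          intro x hx
          have key : ∀ p : W →ₗ[ℝ] ℝ,
              p (x - (f a x / f a x₀) • x₀) = (p - (p x₀ / f a x₀) • f a) x := by
            intro p
            simp only [map_sub, map_smul, LinearMap.sub_apply, LinearMap.smul_apply, smul_eq_mul]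
            ring
          rw [← key]
          refine h _ ?_
          rw [Finset.forall_mem_insert]
          refine ⟨le_of_eq ?_, fun i hi => ?_⟩
          · rw [map_sub, map_smul, smul_eq_mul]
            field_simp
            ring
          · rw [key]
            exact hx i hi)
      refine ⟨Function.update l a ((g x₀ - ∑ i ∈ s, l i * f i x₀) / f a x₀), ?_, fun x => ?_⟩
      · intro i
        by_cases hi : i = a
        · subst hi
          simp only [Function.update_self, Pi.zero_apply]
          refine div_nonneg ?_ hfa.le
          have : ∑ i ∈ s, l i * f i x₀ ≤ 0 :=
            Finset.sum_nonpos fun j hj => mul_nonpos_of_nonneg_of_nonpos (hl j) (hx₀ j hj)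
          linarith
        · simpa [hi] using hl i
      · rw [Finset.sum_insert ha, Function.update_self]
        have hgx := hg x
        simp only [LinearMap.sub_apply, LinearMap.smul_apply, smul_eq_mul, mul_sub,
          Finset.sum_sub_distrib] at hgx
        have e1 : ∑ i ∈ s, Function.update l a ((g x₀ - ∑ i ∈ s, l i * f i x₀) / f a x₀) i * f i x
            = ∑ i ∈ s, l i * f i x := Finset.sum_congr rfl fun i hi => by
          rw [Function.update_of_ne (ne_of_mem_of_not_mem hi ha)]
        have e2 : ∑ i ∈ s, l i * (f i x₀ / f a x₀ * f a x)
            = (∑ i ∈ s, l i * f i x₀) / f a x₀ * f a x := by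
          rw [Finset.sum_div, Finset.sum_mul]
          exact Finset.sum_congr rfl fun i _ => by ring
        rw [e1, sub_div, sub_mul]
        rw [e2] at hgx
        linarith

/-- The Farkas lemma for a system of inequalities in nonnegative variables. -/
theorem exists_nonneg_mulVec_le {I J : Type*} [Fintype I] [Fintype J] (M : Matrix I J ℝ) (b : I → ℝ)
    (h : ∀ q : I → ℝ, 0 ≤ q → 0 ≤ q ᵥ* M → 0 ≤ q ⬝ᵥ b) : ∃ z, 0 ≤ z ∧ M *ᵥ z ≤ b := by
  classical
  by_contra hc
  push Not at hc
  -- Homogenization: the coordinate `none` multiplies `b`. A solution with `w none > 0` could be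
  -- divided by `w none` to solve the original system, so insolubility says that `w none ≤ 0` is a
  -- consequence.
  let f : I ⊕ Option J → (Option J → ℝ) →ₗ[ℝ] ℝ := Sum.elim
    (fun i => ∑ j, M i j • LinearMap.proj (some j) - b i • LinearMap.proj none)
    (fun o => - LinearMap.proj o)
  have hfl : ∀ i w, f (Sum.inl i) w = ∑ j, M i j * w (some j) - b i * w none := by
    intro i w; simp [f]
  have hfr : ∀ o w, f (Sum.inr o) w = - w o := by
    intro o w; simp [f]
  obtain ⟨l, hl, hg⟩ := exists_nonneg_eq_sum_of_forall_nonpos Finset.univ f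
    (LinearMap.proj none) (by
      intro w hw
      by_contra hpos
      simp only [LinearMap.proj_apply, not_le] at hpos
      refine hc (fun j => w (some j) / w none) (fun j => ?_) (fun i => ?_)
      · have := hw (Sum.inr (some j)) (Finset.mem_univ _)
        rw [hfr] at this
        exact div_nonneg (by linarith) hpos.le
      · have := hw (Sum.inl i) (Finset.mem_univ _)
        rw [hfl] at this
        have e : (M *ᵥ fun j => w (some j) / w none) i = (∑ j, M i j * w (some j)) / w none := by
          simp only [Matrix.mulVec, dotProduct, Finset.sum_div, mul_div_assoc]
        rw [e, div_le_iff₀ hpos]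
        linarith)
  simp only [Fintype.sum_sum_type, hfl, hfr, LinearMap.proj_apply] at hg
  -- Comparing coefficients on unit vectors: the multipliers `q` of the rows satisfy `q ᵥ* M ≥ 0`
  -- and `q ⬝ᵥ b ≤ -1`, against `h`.
  have h1 := hg (Pi.single none 1)
  have h2 := fun j => hg (Pi.single (some j) 1)
  simp [Pi.single_apply] at h1
  simp [Pi.single_apply] at h2
  have h3 := h (fun i => l (Sum.inl i)) (fun i => hl _) (fun j => by
    have := h2 j
    have h4 := hl (Sum.inr (some j))
    simp only [Matrix.vecMul, dotProduct, Pi.zero_apply] at h4 ⊢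
    linarith)
  have h4 := hl (Sum.inr none)
  simp only [dotProduct, Pi.zero_apply] at h3 h4
  linarith

/-- Weak duality. It is also applied to homogeneous, scaled and shifted systems, so `r` and `c` are
not fixed data. -/
theorem dotProduct_le_dotProduct_of_feasible {m n : Type*} [Fintype m] [Fintype n]
    {B : Matrix m n ℝ} {r p : m → ℝ} {c y : n → ℝ} (hy : 0 ≤ y) (hr : r ≤ B *ᵥ y) (hp : 0 ≤ p)
    (hc : Bᵀ *ᵥ p ≤ c) : r ⬝ᵥ p ≤ c ⬝ᵥ y := by
  calc r ⬝ᵥ p ≤ (B *ᵥ y) ⬝ᵥ p := dotProduct_le_dotProduct_of_nonneg_right hr hp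
    _ = (Bᵀ *ᵥ p) ⬝ᵥ y := by
      rw [dotProduct_comm, Matrix.dotProduct_mulVec, Matrix.mulVec_transpose]
    _ ≤ c ⬝ᵥ y := dotProduct_le_dotProduct_of_nonneg_right hc hy

/-- Strong duality: a feasible linear program that is bounded below has primal and dual optimal
solutions, with the same value. -/
theorem exists_primal_dual {m n : Type*} [Fintype m] [Fintype n] (B : Matrix m n ℝ) (r : m → ℝ)
    (c : n → ℝ) (hf : ∃ y, 0 ≤ y ∧ r ≤ B *ᵥ y) (hb : ∃ w : ℝ, ∀ y, 0 ≤ y → r ≤ B *ᵥ y → w ≤ c ⬝ᵥ y) :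
    ∃ y p, 0 ≤ y ∧ r ≤ B *ᵥ y ∧ 0 ≤ p ∧ Bᵀ *ᵥ p ≤ c ∧ c ⬝ᵥ y = r ⬝ᵥ p := by
  classical
  obtain ⟨y₀, hy₀, hr₀⟩ := hf
  obtain ⟨w, hw⟩ := hb
  -- One system in `(y, p)`: primal feasibility, dual feasibility, and `c ⬝ᵥ y ≤ r ⬝ᵥ p`. Farkas
  -- reduces its solvability to an inequality on multipliers `(a, v, μ)`.
  obtain ⟨z, hz, hM⟩ := exists_nonneg_mulVec_le
    (Matrix.fromRows (Matrix.fromBlocks (-B) 0 0 Bᵀ)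
      (Matrix.of fun _ : Unit => Sum.elim c (-r)))
    (Sum.elim (Sum.elim (-r) c) 0) (by
      intro q hq hqM
      obtain ⟨q', μ, rfl⟩ : ∃ q' μ, q = Sum.elim q' μ := ⟨_, _, (Sum.elim_comp_inl_inr q).symm⟩
      obtain ⟨a, v, rfl⟩ : ∃ a v, q' = Sum.elim a v := ⟨_, _, (Sum.elim_comp_inl_inr q').symm⟩
      have ha : 0 ≤ a := fun i => hq (Sum.inl (Sum.inl i))
      have hv : 0 ≤ v := fun i => hq (Sum.inl (Sum.inr i))
      have hμ : 0 ≤ μ () := hq (Sum.inr ())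
      have h1 : Bᵀ *ᵥ a ≤ μ () • c := by
        intro j
        have := hqM (Sum.inl j)
        simp [Matrix.vecMul_fromRows, Matrix.vecMul_fromBlocks, Matrix.vecMul_neg] at this
        simp [Matrix.vecMul, dotProduct] at this
        simp [Matrix.mulVec, dotProduct]
        simp_rw [mul_comm (B _ _)]
        linarith
      have h2 : μ () • r ≤ B *ᵥ v := by
        intro j
        have := hqM (Sum.inr j)
        simp [Matrix.vecMul_fromRows, Matrix.vecMul_fromBlocks, Matrix.vecMul_transpose] at this
        simp [Matrix.vecMul, dotProduct] at this
        simpa using this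
      simp only [sumElim_dotProduct_sumElim, dotProduct_zero, dotProduct_neg, add_zero]
      suffices r ⬝ᵥ a ≤ c ⬝ᵥ v by
        rw [dotProduct_comm a, dotProduct_comm v]
        linarith
      -- If `μ = 0`, then `a` and `v` are recession directions: feasibility of `y₀` gives `r ⬝ᵥ a ≤
      -- 0`, boundedness gives `0 ≤ c ⬝ᵥ v`. If `μ > 0`, weak duality scaled by `μ` suffices.
      rcases hμ.eq_or_lt with h0 | hpos
      · rw [← h0, zero_smul] at h1 h2
        have h3 : r ⬝ᵥ a ≤ 0 := by
          simpa using dotProduct_le_dotProduct_of_feasible hy₀ hr₀ ha h1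
        have h4 : 0 ≤ c ⬝ᵥ v := by
          by_contra hneg
          push Not at hneg
          have hc : c ⬝ᵥ v ≠ 0 := hneg.ne
          obtain ⟨t, ht, htw⟩ : ∃ t : ℝ, 0 ≤ t ∧ c ⬝ᵥ y₀ + t * (c ⬝ᵥ v) < w := by
            -- Chosen so that the objective at `y₀ + t • v` equals `w - 1`.
            refine ⟨(w - 1 - c ⬝ᵥ y₀) / (c ⬝ᵥ v), ?_, ?_⟩
            · exact div_nonneg_of_nonpos (by linarith [hw y₀ hy₀ hr₀]) hneg.le
            · rw [div_mul_cancel₀ _ hc]; linarith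
          have := hw (y₀ + t • v) (add_nonneg hy₀ (smul_nonneg ht hv)) (by
            rw [Matrix.mulVec_add, Matrix.mulVec_smul]
            exact hr₀.trans (le_add_of_nonneg_right (smul_nonneg ht h2)))
          rw [dotProduct_add, dotProduct_smul, smul_eq_mul] at this
          linarith
        linarith
      · have h3 := dotProduct_le_dotProduct_of_feasible hv h2 ha h1
        rw [smul_dotProduct, smul_dotProduct, smul_eq_mul, smul_eq_mul] at h3
        exact le_of_mul_le_mul_left h3 hpos)
  obtain ⟨y, p, rfl⟩ : ∃ y p, z = Sum.elim y p := ⟨_, _, (Sum.elim_comp_inl_inr z).symm⟩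
  have hy : 0 ≤ y := fun i => hz (Sum.inl i)
  have hp : 0 ≤ p := fun i => hz (Sum.inr i)
  have h1 : r ≤ B *ᵥ y := fun i => by
    have := hM (Sum.inl (Sum.inl i))
    simp [Matrix.fromRows_mulVec, Matrix.fromBlocks_mulVec, Matrix.neg_mulVec] at this
    exact this
  have h2 : Bᵀ *ᵥ p ≤ c := fun i => by
    have := hM (Sum.inl (Sum.inr i))
    simp [Matrix.fromRows_mulVec, Matrix.fromBlocks_mulVec] at this
    simpa [Matrix.mulVec_transpose] using this
  have h3 : c ⬝ᵥ y ≤ r ⬝ᵥ p := by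
    have := hM (Sum.inr ())
    simp [Matrix.fromRows_mulVec] at this
    simp [Matrix.mulVec] at this
    linarith
  exact ⟨y, p, hy, h1, hp, h2, h3.antisymm (dotProduct_le_dotProduct_of_feasible hy h1 hp h2)⟩

/-- A polyhedron has finitely many extreme points. -/
theorem finite_extremePoints_of_linear {W ι : Type*} [AddCommGroup W] [Module ℝ W] [Finite ι]
    (f : ι → W →ₗ[ℝ] ℝ) (b : ι → ℝ) : (Set.extremePoints ℝ {x | ∀ i, f i x ≤ b i}).Finite := by
  -- An extreme point is determined by its active constraints: if `q ≠ p` has the same ones, short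
  -- moves from `p` along `±(p - q)` stay in the polyhedron.
  refine Set.Finite.of_injOn (f := fun x => {i | f i x = b i}) (t := Set.univ)
    (fun _ _ => Set.mem_univ _) ?_ Set.finite_univ
  intro p hp q hq hpq
  by_contra hne
  have hpm := hp.1
  have hact : ∀ i, f i p = b i → f i (p - q) = 0 := by
    intro i hi
    have h1 : i ∈ {i | f i p = b i} := hi
    have h2 : i ∈ {i | f i q = b i} := by
      have : {i | f i p = b i} = {i | f i q = b i} := hpq
      rwa [← this]
    rw [map_sub, hi, show f i q = b i from h2, sub_self]
  have hev : ∀ᶠ t : ℝ in nhds 0, ∀ i, f i p + t * f i (p - q) ≤ b i := by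
    rw [Filter.eventually_all]
    intro i
    rcases (hpm i).eq_or_lt with h | h
    · refine Filter.Eventually.of_forall fun t => ?_
      rw [hact i h, mul_zero, add_zero, h]
    · have : Filter.Tendsto (fun t : ℝ => f i p + t * f i (p - q)) (nhds 0) (nhds (f i p)) := by
        have : Continuous fun t : ℝ => f i p + t * f i (p - q) := by fun_prop
        simpa using this.tendsto 0
      exact (this.eventually_lt_const h).mono fun _ h => h.le
  obtain ⟨ε, hε, hball⟩ := Metric.eventually_nhds_iff.1 hev
  have hmem : ∀ t : ℝ, |t| < ε → p + t • (p - q) ∈ {x | ∀ i, f i x ≤ b i} := by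
    intro t ht i
    rw [map_add, map_smul, smul_eq_mul]
    exact hball (by simpa using ht) i
  have hε2 : |ε / 2| < ε := by rw [abs_of_pos (by linarith)]; linarith
  have := hp.2 (hmem (ε / 2) hε2) (hmem (-(ε / 2)) (by rwa [abs_neg]))
    ⟨1 / 2, 1 / 2, by norm_num, by norm_num, by norm_num, by module⟩
  have h0 : (ε / 2) • (p - q) = 0 := by simpa using this
  rcases smul_eq_zero.1 h0 with h | h
  · linarith
  · exact hne (sub_eq_zero.1 h)

/-- A linear functional that attains its maximum over a closed set of nonnegative vectors attains it
at an extreme point. -/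
theorem exists_extremePoint_isMax {m : Type*} [Fintype m] {P : Set (m → ℝ)} (hP : IsClosed P)
    (hpos : ∀ p ∈ P, 0 ≤ p) (r : m → ℝ) {p₀ : m → ℝ} (hp₀ : p₀ ∈ P)
    (hmax : ∀ q ∈ P, r ⬝ᵥ q ≤ r ⬝ᵥ p₀) :
    ∃ p ∈ Set.extremePoints ℝ P, ∀ q ∈ P, r ⬝ᵥ q ≤ r ⬝ᵥ p := by
  let l : (m → ℝ) → StrongDual ℝ (m → ℝ) := fun a => ∑ i, a i • ContinuousLinearMap.proj i
  have hl : ∀ a q, l a q = a ⬝ᵥ q := by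
    intro a q; simp [l, dotProduct]
  -- The optimal face may be unbounded, so a second face is cut out by minimizing the coordinate
  -- sum. Nonnegativity makes that face compact, it has an extreme point, and extremality passes up
  -- through both faces.
  have hE₁ : IsExposed ℝ P ((l r).toExposed P) := ContinuousLinearMap.toExposed.isExposed
  have hE₂ : IsExposed ℝ ((l r).toExposed P) ((l (-1)).toExposed ((l r).toExposed P)) :=
    ContinuousLinearMap.toExposed.isExposed
  have hclosed₁ : IsClosed ((l r).toExposed P) := hE₁.isClosed hP
  have hclosed₂ := hE₂.isClosed hclosed₁
  have hp₀' : p₀ ∈ (l r).toExposed P := ⟨hp₀, fun q hq => by rw [hl, hl]; exact hmax q hq⟩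
  have hcpt : ∀ K : ℝ, IsCompact ((l r).toExposed P ∩ {q | ∑ i, q i ≤ K}) := by
    intro K
    refine (isCompact_Icc (a := (0 : m → ℝ)) (b := fun _ => K)).of_isClosed_subset
      (hclosed₁.inter (isClosed_le (by fun_prop) continuous_const)) ?_
    rintro q ⟨hq, hK⟩
    have h0 := hpos q hq.1
    exact ⟨h0, fun i => (Finset.single_le_sum (fun j _ => h0 j) (Finset.mem_univ i)).trans hK⟩
  have hsum : ∀ q, l (-1) q = - ∑ i, q i := by
    intro q; rw [hl]; simp [dotProduct]
  obtain ⟨p₁, hp₁, hmin⟩ := (hcpt (∑ i, p₀ i)).exists_isMinOn ⟨p₀, hp₀', le_refl (∑ i, p₀ i)⟩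
    (f := fun q => ∑ i, q i) (by fun_prop)
  have hp₁' : p₁ ∈ (l (-1)).toExposed ((l r).toExposed P) := by
    refine ⟨hp₁.1, fun q hq => ?_⟩
    rw [hsum, hsum, neg_le_neg_iff]
    rcases le_total (∑ i, q i) (∑ i, p₀ i) with h | h
    · exact hmin ⟨hq, h⟩
    · exact hp₁.2.trans h
  have hcpt₂ : IsCompact ((l (-1)).toExposed ((l r).toExposed P)) := by
    refine (hcpt (∑ i, p₁ i)).of_isClosed_subset hclosed₂ fun q hq => ⟨hq.1, ?_⟩
    have := hq.2 p₁ hp₁.1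
    rw [hsum, hsum, neg_le_neg_iff] at this
    exact this
  obtain ⟨p, hp⟩ := hcpt₂.extremePoints_nonempty ⟨p₁, hp₁'⟩
  refine ⟨p, hE₁.isExtreme.extremePoints_subset_extremePoints
    (hE₂.isExtreme.extremePoints_subset_extremePoints hp), fun q hq => ?_⟩
  have := hp.1.1.2 q hq
  rwa [hl, hl] at this

namespace TwoStageRO

variable {nx mx nu ny my ka ku ky : ℕ} {D : TwoStageRO nx mx nu ny my ka ku ky}

/-! Dual polyhedra -/

theorem isClosed_dualSet : IsClosed D.dualSet :=
  (isClosed_le continuous_const continuous_id).inter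
    (isClosed_le (Continuous.matrix_mulVec continuous_const continuous_id) continuous_const)

theorem isCompact_dualSetF : IsCompact D.dualSetF := by
  refine (isCompact_Icc (a := (0 : Fin ky → ℝ)) (b := fun _ => 1)).of_isClosed_subset ?_ ?_
  · exact (isClosed_le continuous_const continuous_id).inter
      ((isClosed_le (Continuous.matrix_mulVec continuous_const continuous_id)
        continuous_const).inter (isClosed_le (f := fun p : Fin ky → ℝ => ∑ i, p i)
          (by fun_prop) continuous_const))
  · rintro p ⟨h0, -, h1⟩
    exact ⟨h0, fun i =>
      (Finset.single_le_sum (fun j _ => h0 j) (Finset.mem_univ i)).trans h1⟩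

theorem zero_mem_dualSetF : (0 : Fin ky → ℝ) ∈ D.dualSetF :=
  ⟨le_rfl, by rw [Matrix.mulVec_zero], by simp⟩

theorem finite_points : D.points.Finite := by
  have h := finite_extremePoints_of_linear (W := Fin ky → ℝ) (ι := Fin ky ⊕ Fin ny)
    (Sum.elim (fun i => - LinearMap.proj i)
      (fun j => LinearMap.proj j ∘ₗ Matrix.mulVecLin D.B₂cᵀ)) (Sum.elim 0 D.c₂c)
  refine (congrArg (fun P => (Set.extremePoints ℝ P).Finite) ?_).mpr h
  ext p
  simp [dualSet, Pi.le_def, ← Matrix.mulVec_transpose]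

theorem finite_extremePoints_dualSetF : (Set.extremePoints ℝ D.dualSetF).Finite := by
  have h := finite_extremePoints_of_linear (W := Fin ky → ℝ) (ι := (Fin ky ⊕ Fin ny) ⊕ Unit)
    (Sum.elim (Sum.elim (fun i => - LinearMap.proj i)
      (fun j => LinearMap.proj j ∘ₗ Matrix.mulVecLin D.B₂cᵀ))
      (fun _ => ∑ i, LinearMap.proj i)) (Sum.elim 0 1)
  refine (congrArg (fun P => (Set.extremePoints ℝ P).Finite) ?_).mpr h
  ext p
  simp [dualSetF, Pi.le_def, and_assoc, ← Matrix.mulVec_transpose]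

theorem nonempty_extremePoints_dualSetF : (Set.extremePoints ℝ D.dualSetF).Nonempty :=
  isCompact_dualSetF.extremePoints_nonempty ⟨0, zero_mem_dualSetF⟩

/-! Dependence on the scenario -/

theorem continuous_residual_dotProduct (x : XVec nx mx) (yd : Fin my → ℕ) (p : Fin ky → ℝ) :
    Continuous fun u => D.residual x u yd ⬝ᵥ p := by
  unfold residual
  refine Continuous.dotProduct ?_ continuous_const
  exact (continuous_const.sub (Continuous.matrix_mulVec continuous_const continuous_id)).sub
    continuous_const

theorem continuous_term (x : XVec nx mx) (p : (Fin my → ℕ) × (Fin ky → ℝ)) :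
    Continuous fun u => D.term x u p :=
  continuous_const.add (continuous_residual_dotProduct x p.1 p.2)

/-- The maximum of the dual objective over finitely many points depends continuously on the
scenario. -/
theorem exists_continuous_max {P : Set (Fin ky → ℝ)} (hf : P.Finite) (hne : P.Nonempty)
    (x : XVec nx mx) (yd : Fin my → ℕ) :
    ∃ h : (Fin nu → ℝ) → ℝ, Continuous h ∧ ∀ u, (∃ p ∈ P, h u = D.residual x u yd ⬝ᵥ p) ∧
      ∀ p ∈ P, D.residual x u yd ⬝ᵥ p ≤ h u := by
  have hne' : hf.toFinset.Nonempty := by simpa using hne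
  refine ⟨fun u => hf.toFinset.sup' hne' fun p => D.residual x u yd ⬝ᵥ p,
    Continuous.finset_sup'_apply hne' fun p _ => continuous_residual_dotProduct x yd p,
    fun u => ⟨?_, fun p hp => ?_⟩⟩
  · obtain ⟨p, hp, e⟩ := Finset.exists_mem_eq_sup' hne' fun p => D.residual x u yd ⬝ᵥ p
    exact ⟨p, by simpa using hp, e⟩
  · exact Finset.le_sup' (fun p => D.residual x u yd ⬝ᵥ p) (by simpa using hp)

theorem isClosed_U (x : XVec nx mx) : IsClosed (D.U x) :=
  (isClosed_le continuous_const continuous_id).inter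
    (isClosed_le (Continuous.matrix_mulVec continuous_const continuous_id) continuous_const)

theorem isCompact_U (hA2 : D.AssumptionA2) {x : XVec nx mx} (hx : x ∈ D.X) : IsCompact (D.U x) :=
  Metric.isCompact_of_isClosed_isBounded (isClosed_U x) (hA2 x hx)

theorem OU_subset (x : XVec nx mx) (S : PairSet my ky) : D.OU x S ⊆ D.U x := fun _ hu => hu.1

/-- The best `e` for a given scenario is the minimum of the terms. For empty `S` the linear program
would be unbounded and `OU x S` empty. -/
theorem OU_eq (x : XVec nx mx) {S : PairSet my ky} (hS : S.Nonempty) :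
    D.OU x S = {u | u ∈ D.U x ∧ ∀ u' ∈ D.U x,
      S.inf' hS (fun p => D.term x u' p) ≤ S.inf' hS (fun p => D.term x u p)} := by
  ext u
  refine and_congr_right fun _ => ⟨?_, fun h => ?_⟩
  · rintro ⟨e, he, hmax⟩ u' hu'
    exact (hmax u' hu' _ fun p hp => Finset.inf'_le _ hp).trans (Finset.le_inf' hS _ he)
  · exact ⟨_, fun p hp => Finset.inf'_le _ hp, fun u' hu' e' he' =>
      (Finset.le_inf' hS _ he').trans (h u' hu')⟩

theorem continuous_inf_term (x : XVec nx mx) {S : PairSet my ky} (hS : S.Nonempty) :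
    Continuous fun u => S.inf' hS (fun p => D.term x u p) :=
  Continuous.finset_inf'_apply hS fun p _ => continuous_term x p

theorem isCompact_OU (hA2 : D.AssumptionA2) {x : XVec nx mx} (hx : x ∈ D.X) {S : PairSet my ky}
    (hS : S.Nonempty) : IsCompact (D.OU x S) := by
  rw [OU_eq x hS]
  refine (isCompact_U hA2 hx).of_isClosed_subset ?_ fun u hu => hu.1
  simp only [Set.ofPred_and, Set.ofPred_forall]
  exact (isClosed_U x).inter (isClosed_biInter fun u' _ =>
    isClosed_le continuous_const (continuous_inf_term x hS))

theorem nonempty_OU (hA1 : D.AssumptionA1) (hA2 : D.AssumptionA2) {x : XVec nx mx} (hx : x ∈ D.X)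
    {S : PairSet my ky} (hS : S.Nonempty) : (D.OU x S).Nonempty := by
  rw [OU_eq x hS]
  obtain ⟨u, hu, hmax⟩ := (isCompact_U hA2 hx).exists_isMaxOn (hA1 x hx)
    (continuous_inf_term x hS).continuousOn
  exact ⟨u, hu, fun u' hu' => hmax hu'⟩

/-! The feasibility version of the recourse problem -/

/-- Weak duality for the problem with artificial variable; `∑ i, q i ≤ 1` is the dual constraint of
`t`. -/
theorem residual_dotProduct_le {x : XVec nx mx} {u : Fin nu → ℝ} {yd : Fin my → ℕ}
    {yc : Fin ny → ℝ} {t : ℝ} (hyc : 0 ≤ yc) (ht : 0 ≤ t)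
    (hr : D.residual x u yd ≤ D.B₂c *ᵥ yc + fun _ => t) {q : Fin ky → ℝ} (hq : q ∈ D.dualSetF) :
    D.residual x u yd ⬝ᵥ q ≤ t := by
  have h := dotProduct_le_dotProduct_of_feasible (r := D.residual x u yd - fun _ => t) hyc
    (fun i => by simpa using hr i) hq.1 hq.2.1
  have e : (fun _ => t) ⬝ᵥ q = t * ∑ i, q i := by simp [dotProduct, Finset.mul_sum]
  rw [sub_dotProduct, zero_dotProduct, e] at h
  nlinarith [hq.2.2]

/-- Strong duality for `B₂c` with a column of ones appended, which is always feasible (take `t = ∑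
|r i|`) and bounded below by zero; the dual optimum is then moved to an extreme point. -/
theorem exists_isDualf (x : XVec nx mx) (u : Fin nu → ℝ) (yd : Fin my → ℕ) :
    ∃ yc t p, 0 ≤ yc ∧ 0 ≤ t ∧ D.residual x u yd ≤ (D.B₂c *ᵥ yc + fun _ => t) ∧
      D.IsDualf x u yd p ∧ D.residual x u yd ⬝ᵥ p = t := by
  set r := D.residual x u yd with hr
  have hcols : ∀ z : Fin ny ⊕ Unit → ℝ,
      Matrix.fromCols D.B₂c (Matrix.of fun _ (_ : Unit) => (1 : ℝ)) *ᵥ z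
        = D.B₂c *ᵥ (z ∘ Sum.inl) + fun _ => z (Sum.inr ()) := by
    intro z
    rw [Matrix.fromCols_mulVec]
    congr 1
    ext i
    simp [Matrix.mulVec, dotProduct]
  obtain ⟨z, p, hz, hrz, hp, hpc, hzp⟩ := exists_primal_dual
    (Matrix.fromCols D.B₂c (Matrix.of fun _ (_ : Unit) => (1 : ℝ))) r (Sum.elim 0 1)
    ⟨Sum.elim 0 (fun _ => ∑ i, |r i|), by
      rintro (j | j)
      · exact le_rfl
      · exact Finset.sum_nonneg fun i _ => abs_nonneg _, by
      rw [hcols]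
      intro i
      simp only [Sum.elim_comp_inl, Matrix.mulVec_zero, Sum.elim_inr, Pi.add_apply, Pi.zero_apply,
        zero_add]
      exact (le_abs_self _).trans
        (Finset.single_le_sum (f := fun i => |r i|) (fun j _ => abs_nonneg _) (Finset.mem_univ i))⟩
    ⟨0, fun y hy _ => dotProduct_nonneg_of_nonneg (by rintro (j | j) <;> simp) hy⟩
  have hpF : p ∈ D.dualSetF := by
    refine ⟨hp, fun j => ?_, ?_⟩
    · simpa [Matrix.transpose_fromCols, Matrix.fromRows_mulVec] using hpc (Sum.inl j)
    · simpa [Matrix.transpose_fromCols, Matrix.fromRows_mulVec, Matrix.mulVec, dotProduct]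
        using hpc (Sum.inr ())
  have hval : r ⬝ᵥ p = z (Sum.inr ()) := by
    rw [← hzp]
    simp [dotProduct]
  have hmax : ∀ q ∈ D.dualSetF, r ⬝ᵥ q ≤ r ⬝ᵥ p := by
    intro q hq
    rw [hval]
    refine residual_dotProduct_le (yc := z ∘ Sum.inl) (fun j => hz _) (hz (Sum.inr ())) ?_ hq
    rw [← hcols]
    exact hrz
  obtain ⟨p', hp', hmax'⟩ := exists_extremePoint_isMax isCompact_dualSetF.isClosed
    (fun q hq => hq.1) r hpF hmax
  refine ⟨z ∘ Sum.inl, z (Sum.inr ()), p', fun j => hz _, hz (Sum.inr ()), ?_, ⟨hp', hmax'⟩, ?_⟩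
  · rw [← hcols]
    exact hrz
  · rw [← hval]
    exact (hmax p' hp'.1).antisymm (hmax' p hpF)

/-- The violation is finite, attained, and continuous in the scenario. -/
theorem exists_continuous_violation (D : TwoStageRO nx mx nu ny my ka ku ky) (x : XVec nx mx)
    (yd : Fin my → ℕ) :
    ∃ h : (Fin nu → ℝ) → ℝ, Continuous h ∧ ∀ u, D.violation x u yd = (h u : EReal) ∧ 0 ≤ h u ∧
      (∃ p ∈ Set.extremePoints ℝ D.dualSetF, D.residual x u yd ⬝ᵥ p = h u) ∧
      (∃ yc, 0 ≤ yc ∧ D.residual x u yd ≤ D.B₂c *ᵥ yc + fun _ => h u) ∧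
      ∀ yc t, 0 ≤ yc → 0 ≤ t → D.residual x u yd ≤ (D.B₂c *ᵥ yc + fun _ => t) → h u ≤ t := by
  -- By duality the violation is the maximum over finitely many extreme points, each contributing an
  -- affine function of `u`.
  obtain ⟨h, hc, hh⟩ := exists_continuous_max (D := D) finite_extremePoints_dualSetF
    nonempty_extremePoints_dualSetF x yd
  refine ⟨h, hc, fun u => ?_⟩
  obtain ⟨yc, t, p, hyc, ht, hr, hp, hpt⟩ := exists_isDualf (D := D) x u yd
  obtain ⟨⟨p', hp', e⟩, hle⟩ := hh u
  have hmin : ∀ yc t, 0 ≤ yc → 0 ≤ t → D.residual x u yd ≤ (D.B₂c *ᵥ yc + fun _ => t) →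
      h u ≤ t := fun yc t hyc ht hr => by
    rw [e]; exact residual_dotProduct_le hyc ht hr hp'.1
  have ht' : h u = t := (hmin yc t hyc ht hr).antisymm (hpt ▸ hle p hp.1)
  refine ⟨le_antisymm ?_ ?_, ht' ▸ ht, ⟨p', hp', e.symm⟩, ⟨yc, hyc, ht' ▸ hr⟩, hmin⟩
  · rw [ht']
    exact iInf_le_of_le yc (iInf_le_of_le t (iInf_le_of_le ⟨hyc, ht, hr⟩ le_rfl))
  · refine le_iInf fun yc => le_iInf fun t => le_iInf fun hyt => ?_
    exact EReal.coe_le_coe_iff.2 (hmin yc t hyt.1 hyt.2.1 hyt.2.2)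

/-- Serves the subproblem with `K = {u}` and the correction problem with `K = OU x S`. -/
theorem exists_min_violation (hY : D.Yd.Nonempty) (x : XVec nx mx) {K : Set (Fin nu → ℝ)}
    (hK : IsCompact K) (hne : K.Nonempty) :
    ∃ u ∈ K, ∃ z ∈ D.YTilde x u, ∀ u' ∈ K, ∀ z' ∈ D.YTilde x u', z.2 ≤ z'.2 := by
  choose h hc hh using D.exists_continuous_violation x
  obtain ⟨u, hu, hmin⟩ := hK.exists_isMinOn hne
    (Continuous.finset_inf'_apply hY fun y (_ : y ∈ D.Yd) => hc y).continuousOn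
  obtain ⟨y, hy, e⟩ := Finset.exists_mem_eq_inf' hY fun y => h y u
  obtain ⟨-, h0, -, ⟨yc, hyc, hr⟩, -⟩ := hh y u
  refine ⟨u, hu, ((yc, y), h y u), ⟨hyc, hy, h0, hr⟩, fun u' hu' z' hz' => ?_⟩
  have h1 : h z'.1.2 u' ≤ z'.2 := (hh z'.1.2 u').2.2.2.2 _ _ hz'.1 hz'.2.2.1 hz'.2.2.2
  have h2 := Finset.inf'_le (fun y => h y u') hz'.2.1
  have h3 : D.Yd.inf' hY (fun y => h y u) ≤ D.Yd.inf' hY (fun y => h y u') := hmin hu'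
  rw [e] at h3
  exact h3.trans (h2.trans h1)

theorem exists_isIMPf (hA1 : D.AssumptionA1) (hA2 : D.AssumptionA2) {x : XVec nx mx}
    (hx : x ∈ D.X) {Y : Finset (Fin my → ℕ)} (hY : Y.Nonempty) : ∃ u π, D.IsIMPf x Y u π := by
  choose h hc hh using D.exists_continuous_violation x
  have hinf : ∀ u, (⨅ y ∈ Y, D.violation x u y) = ((Y.inf' hY fun y => h y u : ℝ) : EReal) := by
    intro u
    simp_rw [fun y => (hh y u).1]
    refine le_antisymm ?_ (le_iInf₂ fun y hy =>
      EReal.coe_le_coe_iff.2 (Finset.inf'_le (fun y => h y u) hy))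
    obtain ⟨y, hy, e⟩ := Finset.exists_mem_eq_inf' hY fun y => h y u
    rw [e]
    exact iInf₂_le y hy
  obtain ⟨u, hu, hmax⟩ := (isCompact_U hA2 hx).exists_isMaxOn (hA1 x hx)
    (Continuous.finset_inf'_apply hY fun y (_ : y ∈ Y) => hc y).continuousOn
  have hval : (⨅ y ∈ Y, D.violation x u y) = D.impfValue x Y := by
    refine le_antisymm (le_iSup₂ (f := fun u (_ : u ∈ D.U x) => ⨅ y ∈ Y, D.violation x u y) u hu)
      (iSup₂_le fun u' hu' => ?_)
    rw [hinf, hinf]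
    exact EReal.coe_le_coe_iff.2 (hmax hu')
  choose π hπ hπ' using fun y => (hh y u).2.2.1
  refine ⟨u, π, hu, hval, fun y hy => ⟨hπ y, ?_⟩⟩
  rw [← hval, hπ', ← (hh y u).1]
  exact iInf₂_le y hy

theorem impfValue_nonneg (hA1 : D.AssumptionA1) {x : XVec nx mx} (hx : x ∈ D.X)
    (Y : Finset (Fin my → ℕ)) : 0 ≤ D.impfValue x Y := by
  obtain ⟨u, hu⟩ := hA1 x hx
  refine le_iSup₂_of_le u hu (le_iInf₂ fun y _ => ?_)
  refine le_iInf fun yc => le_iInf fun t => le_iInf fun h => ?_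
  exact_mod_cast h.2.1

theorem nonempty_Y_of_impfValue_eq_zero {x : XVec nx mx} {Y : Finset (Fin my → ℕ)}
    (hYd : Y ⊆ D.Yd) (hv : D.impfValue x Y = 0) {u : Fin nu → ℝ} (hu : u ∈ D.U x) :
    (D.Y x u).Nonempty := by
  choose h hc hh using D.exists_continuous_violation x
  have h1 : (⨅ y ∈ Y, D.violation x u y) ≤ 0 := by
    rw [← hv]
    exact le_iSup₂ (f := fun u (_ : u ∈ D.U x) => ⨅ y ∈ Y, D.violation x u y) u hu
  obtain ⟨y, hy, hle⟩ : ∃ y ∈ Y, h y u ≤ 0 := by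
    by_contra hc
    push Not at hc
    rcases Y.eq_empty_or_nonempty with rfl | hne
    -- An infimum over the empty set is `⊤`, which is not at most zero.
    · simp at h1
    · have h2 : ((Y.inf' hne fun y => h y u : ℝ) : EReal) ≤ ⨅ y ∈ Y, D.violation x u y :=
        le_iInf₂ fun y hy => by
          rw [(hh y u).1]
          exact EReal.coe_le_coe_iff.2 (Finset.inf'_le (fun y => h y u) hy)
      obtain ⟨y, hy, e⟩ := Finset.exists_mem_eq_inf' hne fun y => h y u
      rw [e] at h2
      have h3 := h2.trans h1
      exact absurd (hc y hy) (not_lt.2 (by exact_mod_cast h3))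
  obtain ⟨-, h0, -, ⟨yc, hyc, hr⟩, -⟩ := hh y u
  have e : h y u = 0 := le_antisymm hle h0
  refine ⟨(yc, y), hyc, hYd hy, fun i => ?_⟩
  simpa [e] using hr i

/-! The recourse problem -/

theorem term_le_cost {x : XVec nx mx} {u : Fin nu → ℝ} {y : (Fin ny → ℝ) × (Fin my → ℕ)}
    (hy : y ∈ D.Y x u) {q : Fin ky → ℝ} (hq : q ∈ D.dualSet) : D.term x u (y.2, q) ≤ D.cost y := by
  have := dotProduct_le_dotProduct_of_feasible hy.1 hy.2.2 hq.1 hq.2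
  unfold term cost
  linarith

/-- With `x` and the integer part fixed, A3 bounds the continuous recourse problem below, so strong
duality applies. -/
theorem exists_isDualo (hA3 : D.AssumptionA3) {x : XVec nx mx} (hx : x ∈ D.X) {u : Fin nu → ℝ}
    (hu : u ∈ D.U x) {y : (Fin ny → ℝ) × (Fin my → ℕ)} (hy : y ∈ D.Y x u) :
    ∃ yc p, (yc, y.2) ∈ D.Y x u ∧ D.IsDualo x u y.2 p ∧
      D.cost (yc, y.2) = D.term x u (y.2, p) := by
  obtain ⟨w, hw⟩ := hA3
  obtain ⟨yc, p, hyc, hr, hp, hpc, he⟩ := exists_primal_dual D.B₂c (D.residual x u y.2) D.c₂c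
    ⟨y.1, hy.1, hy.2.2⟩ ⟨w - D.c₁ ⬝ᵥ x - D.c₂d ⬝ᵥ castVec y.2, fun yc hyc hr => by
      have := hw x hx u hu (yc, y.2) ⟨hyc, hy.2.1, hr⟩
      simp only [cost] at this
      linarith⟩
  have hmax : ∀ q ∈ D.dualSet, D.residual x u y.2 ⬝ᵥ q ≤ D.residual x u y.2 ⬝ᵥ p := by
    intro q hq
    rw [← he]
    exact dotProduct_le_dotProduct_of_feasible hyc hr hq.1 hq.2
  obtain ⟨p', hp', hmax'⟩ := exists_extremePoint_isMax isClosed_dualSet (fun q hq => hq.1)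
    (D.residual x u y.2) ⟨hp, hpc⟩ hmax
  refine ⟨yc, p', ⟨hyc, hy.2.1, hr⟩, ⟨hp', hmax'⟩, ?_⟩
  have : D.residual x u y.2 ⬝ᵥ p' = D.residual x u y.2 ⬝ᵥ p :=
    (hmax p' hp'.1).antisymm (hmax' p ⟨hp, hpc⟩)
  simp only [cost, term, this, he]
  ring

/-- The cost for a fixed integer decision jumps to `⊤` where the recourse is infeasible. But the
scenarios with zero violation form a closed part of `K`, on which the cost is the continuous `g` up
to a constant; minimize there, then over the finite set `Yd`. -/
theorem exists_min_cost (hA3 : D.AssumptionA3) {x : XVec nx mx} (hx : x ∈ D.X)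
    {K : Set (Fin nu → ℝ)} (hK : IsCompact K) (hKU : K ⊆ D.U x) {u₀ : Fin nu → ℝ} (hu₀ : u₀ ∈ K)
    (hne : (D.Y x u₀).Nonempty) :
    ∃ u ∈ K, ∃ y ∈ D.Y x u, ∀ u' ∈ K, ∀ y' ∈ D.Y x u', D.cost y ≤ D.cost y' := by
  classical
  choose h hc hh using D.exists_continuous_violation x
  obtain ⟨y₀, hy₀⟩ := hne
  have hpts : D.points.Nonempty := by
    obtain ⟨-, p, -, hp, -⟩ := exists_isDualo hA3 hx (hKU hu₀) hy₀
    exact ⟨p, hp.1⟩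
  choose g hgc hg using fun yd => exists_continuous_max (D := D) finite_points hpts x yd
  have hzero : ∀ u (y : (Fin ny → ℝ) × (Fin my → ℕ)), y ∈ D.Y x u → h y.2 u ≤ 0 := by
    intro u y hy
    refine (hh y.2 u).2.2.2.2 y.1 0 hy.1 le_rfl fun i => ?_
    simpa using hy.2.2 i
  have hattain : ∀ u ∈ K, ∀ yd ∈ D.Yd, h yd u ≤ 0 → ∃ yc, (yc, yd) ∈ D.Y x u ∧
      D.cost (yc, yd) = D.c₂d ⬝ᵥ castVec yd + g yd u := by
    intro u hu yd hyd h0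
    obtain ⟨-, h0', -, ⟨yc, hyc, hr⟩, -⟩ := hh yd u
    have e : h yd u = 0 := le_antisymm h0 h0'
    have hmem : (yc, yd) ∈ D.Y x u := ⟨hyc, hyd, fun i => by simpa [e] using hr i⟩
    obtain ⟨yc', p, hy', hp, hcost⟩ := exists_isDualo hA3 hx (hKU hu) hmem
    refine ⟨yc', hy', ?_⟩
    rw [hcost, term]
    congr 1
    obtain ⟨⟨p', hp', e'⟩, hle⟩ := hg yd u
    exact le_antisymm (hle p hp.1) (e' ▸ hp.2 p' hp'.1)
  have hlower : ∀ u (y : (Fin ny → ℝ) × (Fin my → ℕ)), y ∈ D.Y x u →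
      D.c₂d ⬝ᵥ castVec y.2 + g y.2 u ≤ D.cost y := by
    intro u y hy
    obtain ⟨⟨p', hp', e'⟩, -⟩ := hg y.2 u
    rw [e']
    exact term_le_cost hy hp'.1
  have hsel : ∀ yd, ∃ u, (∃ u' ∈ K, h yd u' ≤ 0) →
      u ∈ K ∧ h yd u ≤ 0 ∧ ∀ u' ∈ K, h yd u' ≤ 0 → g yd u ≤ g yd u' := by
    intro yd
    by_cases hex : ∃ u' ∈ K, h yd u' ≤ 0
    · obtain ⟨u, hu, hmin⟩ := (hK.inter_right (isClosed_le (hc yd) continuous_const)).exists_isMinOn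
        hex (hgc yd).continuousOn
      exact ⟨u, fun _ => ⟨hu.1, hu.2, fun u' hu' h' => hmin ⟨hu', h'⟩⟩⟩
    · exact ⟨0, fun h => absurd h hex⟩
  choose v hv using hsel
  obtain ⟨yd, hyd, hmin⟩ := Finset.exists_min_image
    (D.Yd.filter fun yd => ∃ u' ∈ K, h yd u' ≤ 0) (fun yd => D.c₂d ⬝ᵥ castVec yd + g yd (v yd))
    ⟨y₀.2, Finset.mem_filter.2 ⟨hy₀.2.1, u₀, hu₀, hzero u₀ y₀ hy₀⟩⟩
  rw [Finset.mem_filter] at hyd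
  obtain ⟨hvK, hv0, -⟩ := hv yd hyd.2
  obtain ⟨yc, hmem, hcost⟩ := hattain _ hvK yd hyd.1 hv0
  refine ⟨v yd, hvK, (yc, yd), hmem, fun u' hu' y' hy' => ?_⟩
  have hex : ∃ u' ∈ K, h y'.2 u' ≤ 0 := ⟨u', hu', hzero u' y' hy'⟩
  have h1 := hmin y'.2 (Finset.mem_filter.2 ⟨hy'.2.1, hex⟩)
  have h2 := (hv y'.2 hex).2.2 u' hu' (hzero u' y' hy')
  have h3 := hlower u' y' hy'
  rw [hcost]
  linarith

theorem exists_isISPo (hA3 : D.AssumptionA3) {x : XVec nx mx} (hx : x ∈ D.X) {u : Fin nu → ℝ}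
    (hu : u ∈ D.U x) (hne : (D.Y x u).Nonempty) : ∃ y, D.IsISPo x u y := by
  obtain ⟨u', hu', y, hy, hmin⟩ := exists_min_cost hA3 hx (isCompact_singleton (x := u))
    (by simpa using hu) rfl hne
  obtain rfl : u' = u := hu'
  exact ⟨y, hy, hmin u' rfl⟩

theorem recourseValue_eq_cost {x : XVec nx mx} {u : Fin nu → ℝ} {y : (Fin ny → ℝ) × (Fin my → ℕ)}
    (hy : D.IsISPo x u y) : D.recourseValue x u = (D.cost y : EReal) :=
  le_antisymm (iInf₂_le y hy.1) (le_iInf₂ fun y' hy' => EReal.coe_le_coe_iff.2 (hy.2 y' hy'))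

theorem recourseValue_le_worstCase {x : XVec nx mx} {u : Fin nu → ℝ} (hu : u ∈ D.U x) :
    D.recourseValue x u ≤ D.worstCase x :=
  le_iSup₂ (f := fun u (_ : u ∈ D.U x) => D.recourseValue x u) u hu

theorem recourseValue_le_costLP {x : XVec nx mx} {u : Fin nu → ℝ} {yd : Fin my → ℕ}
    (hyd : yd ∈ D.Yd) : D.recourseValue x u ≤ D.costLP x u yd :=
  le_iInf₂ fun yc h => iInf₂_le (yc, yd) ⟨h.1, hyd, h.2⟩

theorem costLP_le_cost {x : XVec nx mx} {u : Fin nu → ℝ} {y : (Fin ny → ℝ) × (Fin my → ℕ)}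
    (hy : y ∈ D.Y x u) : D.costLP x u y.2 ≤ (D.cost y : EReal) :=
  iInf₂_le y.1 ⟨hy.1, hy.2.2⟩

theorem worstCase_le_impoValue (x : XVec nx mx) {Y : Finset (Fin my → ℕ)} (hY : Y ⊆ D.Yd) :
    D.worstCase x ≤ D.impoValue x Y :=
  iSup₂_mono fun _ _ => le_iInf₂ fun _ hy => recourseValue_le_costLP (hY hy)

/-- Attainment is a hypothesis, because the jumps of `costLP` to `⊤` can prevent it. The dual
certificates then always exist: an extreme point when `y` is feasible at `u`, otherwise an extreme
optimum of the feasibility dual, which has positive value and so is a ray. -/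
theorem exists_isIMPo (hA3 : D.AssumptionA3) {x : XVec nx mx} (hx : x ∈ D.X)
    {Y : Finset (Fin my → ℕ)} (hY : Y ⊆ D.Yd) {u : Fin nu → ℝ} (hu : D.AttainsIMPo x Y u) :
    ∃ π, D.IsIMPo x Y u π := by
  have h : ∀ y, ∃ p, y ∈ Y → (p ∈ D.points ∧ D.impoValue x Y ≤ (D.term x u (y, p) : EReal)) ∨
      (p ∈ D.rays ∧ 0 < D.residual x u y ⬝ᵥ p) := by
    intro y
    by_cases hy : y ∈ Y
    · by_cases hf : ∃ yc, (yc, y) ∈ D.Y x u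
      · obtain ⟨yc, hyc⟩ := hf
        obtain ⟨yc', p, hy', hp, hcost⟩ := exists_isDualo hA3 hx hu.1 hyc
        refine ⟨p, fun _ => Or.inl ⟨hp.1, ?_⟩⟩
        have h1 : (⨅ y ∈ Y, D.costLP x u y) ≤ D.costLP x u y := iInf₂_le y hy
        have h2 : D.costLP x u y ≤ (D.cost (yc', y) : EReal) :=
          costLP_le_cost (y := (yc', y)) hy'
        rw [hcost] at h2
        rw [← hu.2]
        exact h1.trans h2
      · obtain ⟨yc, t, p, hyc, ht, hr, hp, hpt⟩ := exists_isDualf (D := D) x u y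
        have htpos : 0 < t := by
          refine lt_of_le_of_ne ht fun h0 => hf ⟨yc, hyc, hY hy, fun i => ?_⟩
          simpa [← h0] using hr i
        refine ⟨p, fun _ => Or.inr ⟨⟨hp.1, ?_⟩, hpt ▸ htpos⟩⟩
        rintro rfl
        rw [dotProduct_zero] at hpt
        exact htpos.ne hpt
    · exact ⟨0, fun h => absurd h hy⟩
  choose π hπ using h
  exact ⟨π, hu, hπ⟩

/-! The outer master problem is a relaxation -/

/-- The sets of pairs that can be collected. -/
def cuts (D : TwoStageRO nx mx nu ny my ka ku ky) : Set (PairSet my ky) :=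
  -- All extreme points of `dualSetF` are admitted, including zero: a feasibility correction at a
  -- scenario of violation zero may add it.
  {S | S.Nonempty ∧ ∀ p ∈ S, p.1 ∈ D.Yd ∧ p.2 ∈ D.points ∪ Set.extremePoints ℝ D.dualSetF}

theorem finite_cuts : D.cuts.Finite := by
  have hT : ((D.Yd : Set (Fin my → ℕ)) ×ˢ
      (D.points ∪ Set.extremePoints ℝ D.dualSetF)).Finite :=
    D.Yd.finite_toSet.prod (finite_points.union finite_extremePoints_dualSetF)
  refine hT.toFinset.powerset.finite_toSet.subset fun S hS => ?_
  rw [Finset.mem_coe, Finset.mem_powerset]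
  intro p hp
  rw [Set.Finite.mem_toFinset]
  exact hS.2 p hp

theorem isFeasible_of_worstCase_ne_top {x : XVec nx mx} (hx : x ∈ D.X) (h : D.worstCase x ≠ ⊤) :
    D.IsFeasible x := by
  refine ⟨hx, fun u hu => ?_⟩
  by_contra hne
  rw [Set.not_nonempty_iff_eq_empty] at hne
  have := recourseValue_le_worstCase (D := D) hu
  rw [recourseValue, hne] at this
  simp only [Set.mem_empty_iff_false, iInf_false, iInf_top, top_le_iff] at this
  exact h this

theorem exists_cost_le_worstCase (hA1 : D.AssumptionA1) (hA2 : D.AssumptionA2)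
    (hA3 : D.AssumptionA3) {x : XVec nx mx} (hx : D.IsFeasible x) {S : PairSet my ky}
    (hS : S.Nonempty) :
    ∃ u ∈ D.OU x S, ∃ y ∈ D.Y x u, (D.cost y : EReal) ≤ D.worstCase x := by
  obtain ⟨u, hu⟩ := nonempty_OU hA1 hA2 hx.1 hS
  obtain ⟨y, hy⟩ := exists_isISPo hA3 hx.1 hu.1 (hx.2 u hu.1)
  refine ⟨u, hu, y, hy.1, ?_⟩
  rw [← recourseValue_eq_cost hy]
  exact recourseValue_le_worstCase hu.1

theorem worstCase_ne_bot (hA1 : D.AssumptionA1) (hA3 : D.AssumptionA3) {x : XVec nx mx}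
    (hx : D.IsFeasible x) : D.worstCase x ≠ ⊥ := by
  obtain ⟨u, hu⟩ := hA1 x hx.1
  obtain ⟨y, hy⟩ := exists_isISPo hA3 hx.1 hu (hx.2 u hu)
  have := recourseValue_le_worstCase (D := D) hu
  rw [recourseValue_eq_cost hy] at this
  exact ((EReal.bot_lt_coe _).trans_le this).ne'

/-- If the worst-case cost of `x'` is finite, `x'` paired with it is feasible in the master problem.
-/
theorem IsOMPSolution.le_objective (hA1 : D.AssumptionA1) (hA2 : D.AssumptionA2)
    (hA3 : D.AssumptionA3) {pool : Set (PairSet my ky)} (hp : pool ⊆ D.cuts) {x : XVec nx mx}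
    {w : EReal} (h : D.IsOMPSolution pool x w) {x' : XVec nx mx} (hx' : x' ∈ D.X) :
    w ≤ D.objective x' := by
  rcases h with ⟨e, -, rfl, hmin⟩ | ⟨-, -, rfl⟩
  · by_cases htop : D.worstCase x' = ⊤
    · rw [objective, htop, EReal.coe_add_top]
      exact le_top
    · have hf := isFeasible_of_worstCase_ne_top hx' htop
      obtain ⟨e', he'⟩ : ∃ e' : ℝ, D.worstCase x' = e' :=
        ⟨_, (EReal.coe_toReal htop (worstCase_ne_bot hA1 hA3 hf)).symm⟩
      rw [objective, he', ← EReal.coe_add, EReal.coe_le_coe_iff]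
      refine hmin x' e' ⟨hx', fun S hS => ?_⟩
      obtain ⟨u, hu, y, hy, hle⟩ := exists_cost_le_worstCase hA1 hA2 hA3 hf (hp hS).1
      rw [he', EReal.coe_le_coe_iff] at hle
      exact ⟨u, hu, y, hy, hle⟩
  · exact bot_le

/-- Finiteness of the pool gives a common bound `e`, so finiteness of the worst-case cost need not
be known. -/
theorem IsFeasible.exists_ompFeasible (hA1 : D.AssumptionA1) (hA2 : D.AssumptionA2)
    (hA3 : D.AssumptionA3) {pool : Set (PairSet my ky)} (hp : pool ⊆ D.cuts) {x : XVec nx mx}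
    (hx : D.IsFeasible x) : ∃ e, D.OMPFeasible pool x e := by
  have h : ∀ S, ∃ e : ℝ, S ∈ pool → ∃ u ∈ D.OU x S, ∃ y ∈ D.Y x u, D.cost y ≤ e := by
    intro S
    by_cases hS : S ∈ pool
    · obtain ⟨u, hu, y, hy, -⟩ := exists_cost_le_worstCase hA1 hA2 hA3 hx (hp hS).1
      exact ⟨D.cost y, fun _ => ⟨u, hu, y, hy, le_rfl⟩⟩
    · exact ⟨0, fun h => absurd h hS⟩
  choose e he using h
  obtain ⟨b, hb⟩ := ((finite_cuts.subset hp).image e).bddAbove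
  refine ⟨b, hx.1, fun S hS => ?_⟩
  obtain ⟨u, hu, y, hy, hle⟩ := he S hS
  exact ⟨u, hu, y, hy, hle.trans (hb ⟨S, hS, rfl⟩)⟩

/-! Invariants -/

/-- Invariant of the data kept by the outer procedure. -/
structure OuterInv (D : TwoStageRO nx mx nu ny my ka ku ky) (st : OuterState nx mx my ky) :
    Prop where
  pool_subset : st.pool ⊆ D.cuts
  incumbent : (st.inc = none ∧ st.ub = ⊤) ∨
    ∃ (x : XVec nx mx) (w : ℝ), st.inc = some x ∧ D.IsFeasible x ∧ D.objective x = w ∧ st.ub = w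

/-- Invariant of an outer iteration at `x`. -/
structure InnerInv (D : TwoStageRO nx mx nu ny my ka ku ky) (st : OuterState nx mx my ky)
    (x : XVec nx mx) : Prop extends OuterInv D st where
  mem : x ∈ D.X
  lb_ne_top : st.lb ≠ ⊤
  lb_le : ∀ x' ∈ D.X, st.lb ≤ D.objective x'
  -- What the master solution leaves behind for the inner subroutines; vacuous for an empty pool,
  -- where `lb = ⊥`.
  cut : ∀ S ∈ st.pool, ∃ e : ℝ, st.lb = ((D.c₁ ⬝ᵥ x + e : ℝ) : EReal) ∧
    ∃ u ∈ D.OU x S, ∃ y ∈ D.Y x u, D.cost y ≤ e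

/-- Correctness of a returned first-stage decision and value. -/
def IsSolution (D : TwoStageRO nx mx nu ny my ka ku ky) (x : XVec nx mx) (v : EReal) : Prop :=
  D.IsOptimal x ∧ D.objective x = v ∧ D.optimalValue = v ∧ ∃ w : ℝ, v = (w : EReal)

/-- Invariant of the control states. -/
def Inv (D : TwoStageRO nx mx nu ny my ka ku ky) : Config nx mx my ky → Prop
  | .outer st => D.OuterInv st
  | .isfPhase1 st x Y => D.InnerInv st x ∧ Y ⊆ D.Yd ∧ Y.Nonempty
  | .isfPhase2 st x S => D.InnerInv st x ∧ S ∈ D.cuts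
  | .isfReturn st x S => D.InnerInv st x ∧ S ∈ D.cuts ∧ S ∉ st.pool
  | .isoPhase1 st x Y l =>
      D.InnerInv st x ∧ D.IsFeasible x ∧ Y ⊆ D.Yd ∧ l ≤ D.worstCase x ∧ l ≠ ⊤
  | .isoPhase2 st x S l v => D.InnerInv st x ∧ D.IsFeasible x ∧ S ∈ D.cuts ∧
      ∃ w : ℝ, D.worstCase x = w ∧ l = w ∧ v = w
  | .isoReturn st x S v => D.InnerInv st x ∧ D.IsFeasible x ∧ S ∈ D.cuts ∧
      (∃ w : ℝ, D.worstCase x = w ∧ v = w) ∧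
      (S ∈ st.pool → ((D.c₁ ⬝ᵥ x : ℝ) : EReal) + v ≤ st.lb)
  | .infeasible => ¬ ∃ x, D.IsFeasible x
  | .done x v => D.IsSolution x v

theorem OuterInv.of_isInitial {st : OuterState nx mx my ky} (h : D.IsInitial st) :
    D.OuterInv st :=
  ⟨fun S hS => ⟨(h.2.2.2 S hS).1, fun p hp => ⟨((h.2.2.2 S hS).2 p hp).1,
    ((h.2.2.2 S hS).2 p hp).2.imp id fun hr => hr.1⟩⟩, Or.inl ⟨h.2.2.1, h.2.1⟩⟩

theorem OuterInv.updateFeas {st : OuterState nx mx my ky} (h : D.OuterInv st) {S : PairSet my ky}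
    (hS : S ∈ D.cuts) : D.OuterInv (updateFeas st S) :=
  ⟨Set.insert_subset hS h.pool_subset, h.incumbent⟩

theorem OuterInv.updateOpt {st : OuterState nx mx my ky} (h : D.OuterInv st) {S : PairSet my ky}
    (hS : S ∈ D.cuts) {x : XVec nx mx} (hx : D.IsFeasible x) {w : ℝ} (hw : D.worstCase x = w) :
    D.OuterInv (D.updateOpt st x S w) := by
  refine ⟨Set.insert_subset hS h.pool_subset, ?_⟩
  by_cases hle : ((D.c₁ ⬝ᵥ x : ℝ) : EReal) + w ≤ st.ub
  · refine Or.inr ⟨x, D.c₁ ⬝ᵥ x + w, if_pos hle, hx, ?_, ?_⟩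
    · rw [objective, hw, EReal.coe_add]
    · exact (min_eq_right hle).trans (EReal.coe_add _ _).symm
  · have e1 : (D.updateOpt st x S w).inc = st.inc := if_neg hle
    have e2 : (D.updateOpt st x S w).ub = st.ub := min_eq_left (not_le.1 hle).le
    rw [e1, e2]
    exact h.incumbent

theorem OuterInv.isSolution {st : OuterState nx mx my ky} (h : D.OuterInv st)
    (hlb : ∀ x' ∈ D.X, st.lb ≤ D.objective x') (hbd : st.ub ≤ st.lb) {x : XVec nx mx}
    (hx : st.inc = some x) : D.IsSolution x st.ub := by
  rcases h.incumbent with ⟨h0, -⟩ | ⟨x', w, hx', hf, hobj, hub⟩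
  · rw [hx] at h0
    exact absurd h0 (by simp)
  · obtain rfl : x = x' := by rw [hx] at hx'; exact Option.some.inj hx'
    have hle : ∀ x' ∈ D.X, D.objective x ≤ D.objective x' := fun x' hx' => by
      rw [hobj, ← hub]
      exact hbd.trans (hlb x' hx')
    refine ⟨⟨hf, hle⟩, by rw [hobj, hub], ?_, w, hub⟩
    rw [hub, ← hobj]
    exact le_antisymm (iInf₂_le x hf.1) (le_iInf₂ hle)

theorem OuterInv.exists_inc {st : OuterState nx mx my ky} (h : D.OuterInv st) (hlb : st.lb ≠ ⊤)
    (hbd : st.ub ≤ st.lb) : ∃ x, st.inc = some x := by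
  rcases h.incumbent with ⟨-, hub⟩ | ⟨x, w, hx, -⟩
  · rw [hub, top_le_iff] at hbd
    exact absurd hbd hlb
  · exact ⟨x, hx⟩

theorem pairs_mem_cuts {Y : Finset (Fin my → ℕ)} {π : (Fin my → ℕ) → Fin ky → ℝ} (hY : Y ⊆ D.Yd)
    (hne : Y.Nonempty) (hπ : ∀ y ∈ Y, π y ∈ D.points ∪ Set.extremePoints ℝ D.dualSetF) :
    pairs Y π ∈ D.cuts := by
  refine ⟨hne.image _, fun p hp => ?_⟩
  obtain ⟨y, hy, rfl⟩ := Finset.mem_image.1 hp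
  exact ⟨hY hy, hπ y hy⟩

theorem insert_mem_cuts {S : PairSet my ky} (hS : S ∈ D.cuts) {y : Fin my → ℕ} {p : Fin ky → ℝ}
    (hy : y ∈ D.Yd) (hp : p ∈ D.points ∪ Set.extremePoints ℝ D.dualSetF) :
    insert (y, p) S ∈ D.cuts := by
  refine ⟨Finset.insert_nonempty _ _, fun q hq => ?_⟩
  rcases Finset.mem_insert.1 hq with rfl | hq
  · exact ⟨hy, hp⟩
  · exact hS.2 q hq

theorem InnerInv.of_isOMPSolution (hA1 : D.AssumptionA1) (hA2 : D.AssumptionA2)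
    (hA3 : D.AssumptionA3) {st : OuterState nx mx my ky} (h : D.OuterInv st) {x : XVec nx mx}
    {w : EReal} (hw : D.IsOMPSolution st.pool x w) : D.InnerInv { st with lb := w } x := by
  refine ⟨⟨h.pool_subset, h.incumbent⟩, ?_, ?_,
    fun x' hx' => hw.le_objective hA1 hA2 hA3 h.pool_subset hx', ?_⟩
  · rcases hw with ⟨e, he, -⟩ | ⟨-, hx, -⟩
    exacts [he.1, hx]
  · rcases hw with ⟨e, -, rfl, -⟩ | ⟨-, -, rfl⟩
    exacts [EReal.coe_ne_top _, bot_ne_top]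
  · intro S hS
    rcases hw with ⟨e, he, rfl, -⟩ | ⟨h0, -, -⟩
    · exact ⟨e, rfl, he.2 S hS⟩
    · exact absurd (show S ∈ (∅ : Set (PairSet my ky)) from h0 ▸ hS) (Set.notMem_empty S)

/-- For a collected `S` the master solution contains a feasible recourse decision at a scenario of
`OU x S`, giving the correction problem value zero. -/
theorem InnerInv.notMem_pool {st : OuterState nx mx my ky} {x : XVec nx mx} (h : D.InnerInv st x)
    {S : PairSet my ky} {u : Fin nu → ℝ} {z : ((Fin ny → ℝ) × (Fin my → ℕ)) × ℝ}
    (hz : D.IsICPf x S u z) (hpos : 0 < z.2) : S ∉ st.pool := by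
  intro hS
  obtain ⟨e, -, u', hu', y, hy, -⟩ := h.cut S hS
  have := hz.2.2 u' hu' (y, 0) ⟨hy.1, hy.2.1, le_rfl, fun i => by simpa using hy.2.2 i⟩
  exact absurd this (not_le.2 hpos)

/-- Ensures that the optimality subroutine, which may start from no integer decision, never builds
an empty `S`. -/
theorem impoValue_empty (hA1 : D.AssumptionA1) {x : XVec nx mx} (hx : x ∈ D.X) :
    D.impoValue x ∅ = ⊤ := by
  obtain ⟨u, hu⟩ := hA1 x hx
  refine top_le_iff.1 (le_iSup₂_of_le u hu ?_)
  simp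

theorem Inv.step (hA1 : D.AssumptionA1) (hA2 : D.AssumptionA2) (hA3 : D.AssumptionA3)
    {c c' : Config nx mx my ky} (h : D.Inv c) (hs : D.Step c c') : D.Inv c' := by
  cases hs with
  | outer_infeasible st hinf =>
    rintro ⟨x, hx⟩
    obtain ⟨e, he⟩ := hx.exists_ompFeasible hA1 hA2 hA3 h.pool_subset
    exact hinf ⟨x, e, he⟩
  | outer_solve st x w Y hw hY hne => exact ⟨.of_isOMPSolution hA1 hA2 hA3 h hw, hY, hne⟩
  | isf_feasible st x Y u π Y₀ _ hv hY₀ =>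
    exact ⟨h.1, ⟨h.1.mem, fun u hu => nonempty_Y_of_impfValue_eq_zero h.2.1 hv hu⟩, hY₀, bot_le,
      bot_ne_top⟩
  | isf_expand st x Y u π z _ _ hz _ =>
    exact ⟨h.1, Finset.insert_subset hz.1.2.1 h.2.1, Finset.insert_nonempty _ _⟩
  | isf_phase2 st x Y u π z hu _ _ _ =>
    exact ⟨h.1, pairs_mem_cuts h.2.1 h.2.2 fun y hy => Or.inr (hu.2.2 y hy).1⟩
  | isf_correct st x S u z p hz _ hp =>
    exact ⟨h.1, insert_mem_cuts h.2 hz.2.1.2.1 (Or.inr hp.1)⟩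
  | isf_return st x S u z hz hpos => exact ⟨h.1, h.2, h.1.notMem_pool hz hpos⟩
  | iso_expand st x Y l u π y hu hy _ =>
    refine ⟨h.1, h.2.1, Finset.insert_subset hy.1.2.1 h.2.2.1, max_le h.2.2.2.1 ?_, ?_⟩
    · rw [← recourseValue_eq_cost hy]
      exact recourseValue_le_worstCase hu.1.1
    · exact (max_lt (lt_top_iff_ne_top.2 h.2.2.2.2) (EReal.coe_lt_top _)).ne
  | iso_phase2 st x Y l u π y hu hy hle =>
    obtain ⟨hin, hf, hY, hl, hlt⟩ := h
    have h1 : max l (D.cost y : EReal) ≤ D.worstCase x := by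
      refine max_le hl ?_
      rw [← recourseValue_eq_cost hy]
      exact recourseValue_le_worstCase hu.1.1
    -- The sandwich `l ≤ worstCase ≤ impoValue ≤ l` makes all three equal; `h3` and `h4` make the
    -- common value real.
    have h2 := worstCase_le_impoValue x hY
    have h3 : max l (D.cost y : EReal) ≠ ⊤ :=
      (max_lt (lt_top_iff_ne_top.2 hlt) (EReal.coe_lt_top _)).ne
    have h4 : max l (D.cost y : EReal) ≠ ⊥ :=
      ((EReal.bot_lt_coe (D.cost y)).trans_le (le_max_right _ _)).ne'
    have hne : Y.Nonempty := by
      rw [Finset.nonempty_iff_ne_empty]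
      rintro rfl
      rw [impoValue_empty hA1 hin.mem, top_le_iff] at hle
      exact h3 hle
    refine ⟨hin, hf, pairs_mem_cuts hY hne fun y hy => ?_, _, ?_,
      (EReal.coe_toReal h3 h4).symm, ?_⟩
    · exact (hu.2 y hy).imp (fun h => h.1) fun h => h.1.1
    · rw [EReal.coe_toReal h3 h4]
      exact le_antisymm (h2.trans hle) h1
    · rw [EReal.coe_toReal h3 h4]
      exact le_antisymm hle (h1.trans h2)
  | iso_correct st x S l v u y p hy _ hp =>
    exact ⟨h.1, h.2.1, insert_mem_cuts h.2.2.1 hy.2.1.2.1 (Or.inl hp.1), h.2.2.2⟩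
  | iso_return st x S l v u y hy hle =>
    obtain ⟨hin, hf, hS, w, hw, rfl, rfl⟩ := h
    refine ⟨hin, hf, hS, ⟨w, hw, rfl⟩, fun hmem => ?_⟩
    -- For a regenerated `S`: `w ≤ cost y ≤ cost y' ≤ e`, while `lb = c₁ x + e`.
    obtain ⟨e, he, u', hu', y', hy', hle'⟩ := hin.cut S hmem
    rw [not_lt, EReal.coe_le_coe_iff] at hle
    rw [he, ← EReal.coe_add, EReal.coe_le_coe_iff]
    linarith [hy.2.2 u' hu' y' hy']
  | feas_stop st x S x' hbd hx' =>
    exact (h.1.toOuterInv.updateFeas h.2.1).isSolution h.1.lb_le hbd hx'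
  | feas_continue st x S _ => exact h.1.toOuterInv.updateFeas h.2.1
  | opt_stop st x S v x' hbd hx' =>
    obtain ⟨hin, hf, hS, ⟨w, hw, rfl⟩, -⟩ := h
    exact (hin.toOuterInv.updateOpt hS hf hw).isSolution hin.lb_le hbd hx'
  | opt_continue st x S v _ =>
    obtain ⟨hin, hf, hS, ⟨w, hw, rfl⟩, -⟩ := h
    exact hin.toOuterInv.updateOpt hS hf hw

theorem ub_updateOpt_le_lb {st : OuterState nx mx my ky} {x : XVec nx mx} {S : PairSet my ky}
    {v : EReal} (h : D.Inv (.isoReturn st x S v)) (hS : S ∈ st.pool) :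
    (D.updateOpt st x S v).ub ≤ (D.updateOpt st x S v).lb :=
  (min_le_right _ _).trans (h.2.2.2.2 hS)

/-! The number of outer iterations -/

/-- Upper bound on the number `k` of outer iterations in terms of the number of collected sets. -/
def CountInv (D : TwoStageRO nx mx nu ny my ka ku ky) (k : ℕ) : Config nx mx my ky → Prop
  | .outer st => k ≤ st.pool.ncard
  | .isfPhase1 st _ _ => k ≤ st.pool.ncard + 1
  | .isfPhase2 st _ _ => k ≤ st.pool.ncard + 1
  | .isfReturn st _ _ => k ≤ st.pool.ncard + 1
  | .isoPhase1 st _ _ _ => k ≤ st.pool.ncard + 1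
  | .isoPhase2 st _ _ _ _ => k ≤ st.pool.ncard + 1
  | .isoReturn st _ _ _ => k ≤ st.pool.ncard + 1
  | .infeasible => k ≤ D.cuts.ncard + 1
  | .done _ _ => k ≤ D.cuts.ncard + 1

theorem OuterInv.ncard_le {st : OuterState nx mx my ky} (h : D.OuterInv st) :
    st.pool.ncard ≤ D.cuts.ncard :=
  Set.ncard_le_ncard h.pool_subset finite_cuts

theorem OuterInv.ncard_insert {st : OuterState nx mx my ky} (h : D.OuterInv st)
    {S : PairSet my ky} (hS : S ∉ st.pool) : (insert S st.pool).ncard = st.pool.ncard + 1 :=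
  Set.ncard_insert_of_notMem hS (finite_cuts.subset h.pool_subset)

theorem CountInv.le {k : ℕ} {c : Config nx mx my ky} (h : D.CountInv k c) (hc : D.Inv c) :
    k ≤ D.cuts.ncard + 1 := by
  cases c with
  | outer st => exact h.trans (hc.ncard_le.trans (Nat.le_succ _))
  | isfPhase1 st x Y => exact h.trans (Nat.succ_le_succ hc.1.ncard_le)
  | isfPhase2 st x S => exact h.trans (Nat.succ_le_succ hc.1.ncard_le)
  | isfReturn st x S => exact h.trans (Nat.succ_le_succ hc.1.ncard_le)
  | isoPhase1 st x Y l => exact h.trans (Nat.succ_le_succ hc.1.ncard_le)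
  | isoPhase2 st x S l v => exact h.trans (Nat.succ_le_succ hc.1.ncard_le)
  | isoReturn st x S v => exact h.trans (Nat.succ_le_succ hc.1.ncard_le)
  | infeasible => exact h
  | done x v => exact h

theorem CountInv.step_outer {k : ℕ} {st : OuterState nx mx my ky} {c' : Config nx mx my ky}
    (hc : D.OuterInv st) (h : D.CountInv k (.outer st)) (hs : D.Step (.outer st) c') :
    D.CountInv (k + 1) c' := by
  cases hs with
  | outer_infeasible _ _ => exact Nat.succ_le_succ (h.trans hc.ncard_le)
  | outer_solve _ x w Y _ _ _ => exact Nat.succ_le_succ h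

theorem CountInv.step_inner {k : ℕ} {c c' : Config nx mx my ky} (hc : D.Inv c)
    (h : D.CountInv k c) (hne : ∀ st, c ≠ .outer st) (hs : D.Step c c') : D.CountInv k c' := by
  have hle := h.le hc
  cases hs with
  | outer_infeasible st _ => exact absurd rfl (hne st)
  | outer_solve st _ _ _ _ _ _ => exact absurd rfl (hne st)
  -- Returning to the outer problem turns `ncard + 1` into the cardinality of the enlarged pool,
  -- because `S` is new.
  | feas_continue st x S _ => exact h.trans (hc.1.ncard_insert hc.2.2).ge
  | opt_continue st x S v hbd =>
    exact h.trans (hc.1.ncard_insert fun hS => hbd (ub_updateOpt_le_lb hc hS)).ge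
  | _ => first | exact h | exact hle

theorem Execution.inv (hA1 : D.AssumptionA1) (hA2 : D.AssumptionA2) (hA3 : D.AssumptionA3)
    {st₀ : OuterState nx mx my ky} (h₀ : D.IsInitial st₀) {k : ℕ} {c : Config nx mx my ky}
    (h : D.Execution st₀ k c) : D.Inv c ∧ D.CountInv k c := by
  induction h with
  | start => exact ⟨OuterInv.of_isInitial h₀, Nat.zero_le _⟩
  | outer k st c' _ hs ih => exact ⟨ih.1.step hA1 hA2 hA3 hs, ih.2.step_outer ih.1 hs⟩
  | inner k c c' _ hne hs ih => exact ⟨ih.1.step hA1 hA2 hA3 hs, ih.2.step_inner ih.1 hne hs⟩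

/-! Termination up to the correction phases -/

/-- A quantity that decreases in every step outside the correction phases. -/
def rank (D : TwoStageRO nx mx nu ny my ka ku ky) : Config nx mx my ky → ℕ
  -- One missing set weighs `2 * D.Yd.card + 10`, one more than the offset of `outer`, so collecting
  -- a set pays for a whole iteration. The two copies of `D.Yd.card` pay for the two first phases.
  | .outer st => (D.cuts.ncard - st.pool.ncard) * (2 * D.Yd.card + 10) + 2 * D.Yd.card + 9
  | .isfPhase1 st _ Y => (D.cuts.ncard - st.pool.ncard) * (2 * D.Yd.card + 10) +
      D.Yd.card + 8 + (D.Yd.card - Y.card)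
  | .isfPhase2 st _ _ => (D.cuts.ncard - st.pool.ncard) * (2 * D.Yd.card + 10) + D.Yd.card + 7
  | .isfReturn st _ _ => (D.cuts.ncard - st.pool.ncard) * (2 * D.Yd.card + 10) + D.Yd.card + 6
  | .isoPhase1 st _ Y _ => (D.cuts.ncard - st.pool.ncard) * (2 * D.Yd.card + 10) +
      5 + (D.Yd.card - Y.card)
  | .isoPhase2 st _ _ _ _ => (D.cuts.ncard - st.pool.ncard) * (2 * D.Yd.card + 10) + 4
  | .isoReturn st _ _ _ => (D.cuts.ncard - st.pool.ncard) * (2 * D.Yd.card + 10) + 3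
  | .infeasible => 0
  | .done _ _ => 0

/-- Both control states belong to the same correction phase. -/
def SamePhase (c c' : Config nx mx my ky) : Prop :=
  (∃ st x S S', c = .isfPhase2 st x S ∧ c' = .isfPhase2 st x S') ∨
  ∃ st x S S' l v, c = .isoPhase2 st x S l v ∧ c' = .isoPhase2 st x S' l v

/-- A decision of `Y` repairing `u` would make the violation minimum at `u`, which is the positive
inner value, zero. -/
theorem IsIMPf.notMem {x : XVec nx mx} {Y : Finset (Fin my → ℕ)}
    {u : Fin nu → ℝ} {π : (Fin my → ℕ) → Fin ky → ℝ} (hu : D.IsIMPf x Y u π)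
    (hv : 0 < D.impfValue x Y) {z : ((Fin ny → ℝ) × (Fin my → ℕ)) × ℝ} (hz : D.IsISPf x u z)
    (h0 : z.2 = 0) : z.1.2 ∉ Y := by
  intro hmem
  have h1 : (⨅ y ∈ Y, D.violation x u y) ≤ D.violation x u z.1.2 := iInf₂_le z.1.2 hmem
  have h2 : D.violation x u z.1.2 ≤ (z.2 : EReal) :=
    iInf_le_of_le z.1.1 (iInf_le_of_le z.2 (iInf_le_of_le ⟨hz.1.1, hz.1.2.2.1, hz.1.2.2.2⟩ le_rfl))
  rw [hu.2.1] at h1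
  rw [h0, EReal.coe_zero] at h2
  exact absurd (h1.trans h2) (not_le.2 hv)

theorem IsIMPo.notMem {x : XVec nx mx} {Y : Finset (Fin my → ℕ)} {u : Fin nu → ℝ}
    {π : (Fin my → ℕ) → Fin ky → ℝ} (hu : D.IsIMPo x Y u π) {y : (Fin ny → ℝ) × (Fin my → ℕ)}
    (hy : D.IsISPo x u y) (hv : (D.cost y : EReal) < D.impoValue x Y) : y.2 ∉ Y := by
  intro hmem
  have h1 : (⨅ y ∈ Y, D.costLP x u y) ≤ D.costLP x u y.2 := iInf₂_le y.2 hmem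
  rw [hu.1.2] at h1
  exact absurd (h1.trans (costLP_le_cost hy.1)) (not_le.2 hv)

/-- Corrections are exempt because nothing here shows that they enlarge `S`. -/
theorem Inv.rank_step (hA1 : D.AssumptionA1) {c c' : Config nx mx my ky} (h : D.Inv c)
    (hs : D.Step c c') : D.rank c' < D.rank c ∨ SamePhase c c' := by
  have hcard : ∀ {Y : Finset (Fin my → ℕ)} {y}, Y ⊆ D.Yd → y ∈ D.Yd → y ∉ Y →
      D.Yd.card - (insert y Y).card < D.Yd.card - Y.card := by
    intro Y y hY hy hn
    have h1 := Finset.card_le_card (Finset.insert_subset hy hY)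
    have h2 := Finset.card_insert_of_notMem hn
    omega
  have hpool : ∀ {st : OuterState nx mx my ky} {S : PairSet my ky}, D.OuterInv st → S ∈ D.cuts →
      S ∉ st.pool → (D.cuts.ncard - (insert S st.pool).ncard) * (2 * D.Yd.card + 10) +
        (2 * D.Yd.card + 10) = (D.cuts.ncard - st.pool.ncard) * (2 * D.Yd.card + 10) := by
    intro st S hst hS hn
    have h1 := Set.ncard_le_ncard (Set.insert_subset hS hst.pool_subset) finite_cuts
    have h2 := hst.ncard_insert hn
    rw [← Nat.succ_mul]
    congr 1
    omega
  cases hs with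
  | outer_infeasible st _ => left; simp only [rank]; omega
  | outer_solve st x w Y _ _ _ => left; simp only [rank]; omega
  | isf_feasible st x Y u π Y₀ _ _ _ => left; simp only [rank]; omega
  | isf_expand st x Y u π z hu hv hz h0 =>
    have hpos := lt_of_le_of_ne (impfValue_nonneg hA1 h.1.mem Y) (Ne.symm hv)
    have := hcard h.2.1 hz.1.2.1 (hu.notMem hpos hz h0)
    left; simp only [rank]; omega
  | isf_phase2 st x Y u π z _ _ _ _ => left; simp only [rank]; omega
  | isf_correct st x S u z p _ _ _ => exact Or.inr (Or.inl ⟨st, x, S, _, rfl, rfl⟩)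
  | isf_return st x S u z _ _ => left; simp only [rank]; omega
  | iso_expand st x Y l u π y hu hy hv =>
    have hlt := (le_max_right l (D.cost y : EReal)).trans_lt (not_le.1 hv)
    have := hcard h.2.2.1 hy.1.2.1 (hu.notMem hy hlt)
    left; simp only [rank]; omega
  | iso_phase2 st x Y l u π y _ _ _ => left; simp only [rank]; omega
  | iso_correct st x S l v u y p _ _ _ => exact Or.inr (Or.inr ⟨st, x, S, _, l, v, rfl, rfl⟩)
  | iso_return st x S l v u y _ _ => left; simp only [rank]; omega
  | feas_stop st x S x' _ _ => left; simp only [rank]; omega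
  | feas_continue st x S _ =>
    have := hpool h.1.toOuterInv h.2.1 h.2.2
    left; simp only [rank, TwoStageRO.updateFeas]; omega
  | opt_stop st x S v x' _ _ => left; simp only [rank]; omega
  | opt_continue st x S v hbd =>
    have := hpool h.1.toOuterInv h.2.2.1 fun hS => hbd (ub_updateOpt_le_lb h hS)
    left; simp only [rank, TwoStageRO.updateOpt]; omega

theorem eventually_samePhase (hA1 : D.AssumptionA1) {c : ℕ → Config nx mx my ky}
    (hinv : ∀ n, D.Inv (c n)) (hs : ∀ n, D.Step (c n) (c (n + 1))) :
    ∃ n₀ st x, (∀ n ≥ n₀, ∃ S, c n = .isfPhase2 st x S) ∨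
      ∃ l v, ∀ n ≥ n₀, ∃ S, c n = .isoPhase2 st x S l v := by
  have hrank : ∀ n, D.rank (c (n + 1)) < D.rank (c n) ∨ SamePhase (c n) (c (n + 1)) :=
    fun n => (hinv n).rank_step hA1 (hs n)
  have hmono : ∀ n, D.rank (c (n + 1)) ≤ D.rank (c n) := by
    intro n
    rcases hrank n with h | ⟨st, x, S, S', h, h'⟩ | ⟨st, x, S, S', l, v, h, h'⟩
    · exact h.le
    · rw [h, h']; exact le_rfl
    · rw [h, h']; exact le_rfl
  -- From an index of minimal rank on, no step can lower the rank, so all are corrections; these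
  -- preserve the phase and its data apart from `S`.
  obtain ⟨n₀, hn₀⟩ : ∃ n₀, ∀ n, D.rank (c n₀) ≤ D.rank (c n) := by
    obtain ⟨n₀, h⟩ := Nat.sInf_mem (Set.range_nonempty fun n => D.rank (c n))
    exact ⟨n₀, fun n => h.le.trans (Nat.sInf_le ⟨n, rfl⟩)⟩
  have hsame : ∀ n ≥ n₀, SamePhase (c n) (c (n + 1)) := by
    intro n hn
    refine (hrank n).resolve_left fun hlt => ?_
    have := antitone_nat_of_succ_le (f := fun n => D.rank (c n)) hmono hn
    exact absurd (hlt.trans_le this) (not_lt.2 (hn₀ (n + 1)))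
  refine ⟨n₀, ?_⟩
  rcases hsame n₀ le_rfl with ⟨st, x, S, S', h, -⟩ | ⟨st, x, S, S', l, v, h, -⟩
  · refine ⟨st, x, Or.inl fun n hn => ?_⟩
    induction n, hn using Nat.le_induction with
    | base => exact ⟨S, h⟩
    | succ n hn ih =>
      obtain ⟨T, hT⟩ := ih
      rcases hsame n hn with ⟨st', x', U, U', h1, h2⟩ | ⟨st', x', U, U', l, v, h1, h2⟩
      · rw [hT] at h1
        cases h1
        exact ⟨U', h2⟩
      · rw [hT] at h1
        cases h1
  · refine ⟨st, x, Or.inr ⟨l, v, fun n hn => ?_⟩⟩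
    induction n, hn using Nat.le_induction with
    | base => exact ⟨S, h⟩
    | succ n hn ih =>
      obtain ⟨T, hT⟩ := ih
      rcases hsame n hn with ⟨st', x', U, U', h1, h2⟩ | ⟨st', x', U, U', l', v', h1, h2⟩
      · rw [hT] at h1
        cases h1
      · rw [hT] at h1
        cases h1
        exact ⟨U', h2⟩

theorem exists_execution {st₀ : OuterState nx mx my ky} {c : ℕ → Config nx mx my ky}
    (h₀ : c 0 = .outer st₀) (hs : ∀ n, D.Step (c n) (c (n + 1))) (n : ℕ) :
    ∃ k, D.Execution st₀ k (c n) := by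
  induction n with
  | zero => exact ⟨0, h₀ ▸ .start⟩
  | succ n ih =>
    obtain ⟨k, hk⟩ := ih
    by_cases h : ∃ st, c n = .outer st
    · obtain ⟨st, hst⟩ := h
      exact ⟨k + 1, .outer k st _ (hst ▸ hk) (hst ▸ hs n)⟩
    · exact ⟨k, .inner k (c n) _ hk (fun st hst => h ⟨st, hst⟩) (hs n)⟩

/-! Executions that cannot be continued -/

theorem Inv.terminated_of_stuck (hY : D.Yd.Nonempty) (hA1 : D.AssumptionA1)
    (hA2 : D.AssumptionA2) (hA3 : D.AssumptionA3) {c : Config nx mx my ky} (h : D.Inv c)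
    (hstuck : ∀ c', ¬ D.Step c c') :
    c = .infeasible ∨ (∃ x v, c = .done x v) ∨
      (∃ st, c = .outer st ∧ (∃ x e, D.OMPFeasible st.pool x e) ∧
        ¬ ∃ x w, D.IsOMPSolution st.pool x w) ∨
      (∃ st x Y l, c = .isoPhase1 st x Y l ∧ ¬ ∃ u, D.AttainsIMPo x Y u) := by
  cases c with
  | infeasible => exact Or.inl rfl
  | done x v => exact Or.inr (Or.inl ⟨x, v, rfl⟩)
  | outer st =>
    refine Or.inr (Or.inr (Or.inl ⟨st, rfl, ?_, ?_⟩))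
    · by_contra hc
      exact hstuck _ (.outer_infeasible st hc)
    · rintro ⟨x, w, hw⟩
      exact hstuck _ (.outer_solve st x w D.Yd hw subset_rfl hY)
  | isfPhase1 st x Y =>
    exfalso
    obtain ⟨u, π, hu⟩ := exists_isIMPf hA1 hA2 h.1.mem h.2.2
    by_cases hv : D.impfValue x Y = 0
    -- Any admissible start of the optimality subroutine shows that a step exists; the empty one is
    -- allowed.
    · exact hstuck _ (.isf_feasible st x Y u π ∅ hu hv (Finset.empty_subset _))
    · obtain ⟨u', hu', z, hz, hmin⟩ := exists_min_violation hY x (isCompact_singleton (x := u))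
        (Set.singleton_nonempty u)
      obtain rfl : u' = u := hu'
      have hz' : D.IsISPf x u' z := ⟨hz, hmin u' rfl⟩
      rcases hz.2.2.1.eq_or_lt with h0 | hpos
      · exact hstuck _ (.isf_expand st x Y u' π z hu hv hz' h0.symm)
      · exact hstuck _ (.isf_phase2 st x Y u' π z hu hv hz' hpos)
  | isfPhase2 st x S =>
    exfalso
    obtain ⟨u, hu, z, hz, hmin⟩ := exists_min_violation hY x
      (isCompact_OU hA2 h.1.mem h.2.1) (nonempty_OU hA1 hA2 h.1.mem h.2.1)
    rcases hz.2.2.1.eq_or_lt with h0 | hpos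
    · obtain ⟨-, -, p, -, -, -, hp, -⟩ := exists_isDualf (D := D) x u z.1.2
      exact hstuck _ (.isf_correct st x S u z p ⟨hu, hz, hmin⟩ h0.symm hp)
    · exact hstuck _ (.isf_return st x S u z ⟨hu, hz, hmin⟩ hpos)
  | isfReturn st x S =>
    exfalso
    by_cases hbd : (TwoStageRO.updateFeas st S).ub ≤ (TwoStageRO.updateFeas st S).lb
    · obtain ⟨x', hx'⟩ := (h.1.toOuterInv.updateFeas h.2.1).exists_inc h.1.lb_ne_top hbd
      exact hstuck _ (Step.feas_stop st x S x' hbd hx')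
    · exact hstuck _ (.feas_continue st x S hbd)
  | isoPhase1 st x Y l =>
    refine Or.inr (Or.inr (Or.inr ⟨st, x, Y, l, rfl, ?_⟩))
    rintro ⟨u, hu⟩
    obtain ⟨π, hπ⟩ := exists_isIMPo hA3 h.1.mem h.2.2.1 hu
    obtain ⟨y, hy⟩ := exists_isISPo hA3 h.1.mem hu.1 (h.2.1.2 u hu.1)
    by_cases hle : D.impoValue x Y ≤ max l (D.cost y : EReal)
    · exact hstuck _ (.iso_phase2 st x Y l u π y hπ hy hle)
    · exact hstuck _ (.iso_expand st x Y l u π y hπ hy hle)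
  | isoPhase2 st x S l v =>
    exfalso
    obtain ⟨hin, hf, hS, -⟩ := h
    obtain ⟨u₀, hu₀⟩ := nonempty_OU hA1 hA2 hin.mem hS.1
    obtain ⟨u, hu, y, hy, hmin⟩ := exists_min_cost hA3 hin.mem (isCompact_OU hA2 hin.mem hS.1)
      (OU_subset x S) hu₀ (hf.2 u₀ hu₀.1)
    by_cases hlt : (D.cost y : EReal) < l
    · obtain ⟨-, p, -, hp, -⟩ := exists_isDualo hA3 hin.mem hu.1 hy
      exact hstuck _ (.iso_correct st x S l v u y p ⟨hu, hy, hmin⟩ hlt hp)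
    · exact hstuck _ (.iso_return st x S l v u y ⟨hu, hy, hmin⟩ hlt)
  | isoReturn st x S v =>
    exfalso
    obtain ⟨hin, hf, hS, ⟨w, hw, rfl⟩, -⟩ := h
    by_cases hbd : (D.updateOpt st x S w).ub ≤ (D.updateOpt st x S w).lb
    · obtain ⟨x', hx'⟩ := (hin.toOuterInv.updateOpt hS hf hw).exists_inc hin.lb_ne_top hbd
      exact hstuck _ (Step.opt_stop st x S w x' hbd hx')
    · exact hstuck _ (.opt_continue st x S w hbd)

end TwoStageRO

end NestedCCG

end

theorem mainTheorem3 {nx mx nu ny my ka ku ky : ℕ}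
    (D : NestedCCG.TwoStageRO nx mx nu ny my ka ku ky)
    (hY : D.Yd.Nonempty) (hA1 : D.AssumptionA1) (hA2 : D.AssumptionA2) (hA3 : D.AssumptionA3) :
    -- the number of outer iterations is bounded by a number that depends on the data only
    (∃ N : ℕ, ∀ st₀, D.IsInitial st₀ → ∀ k c, D.Execution st₀ k c → k ≤ N) ∧
    ∀ st₀, D.IsInitial st₀ →
      -- the feasibility subroutine never returns a set that has been collected before
      (∀ k st x S, D.Execution st₀ k (.isfReturn st x S) → S ∉ st.pool) ∧
      -- if the optimality subroutine does so, the algorithm terminates at once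
      (∀ k st x S v, D.Execution st₀ k (.isoReturn st x S v) → S ∈ st.pool →
        ∀ c', D.Step (.isoReturn st x S v) c' → ∃ x' v', c' = .done x' v') ∧
      -- if infeasibility is reported, the two-stage problem is infeasible
      (∀ k, D.Execution st₀ k .infeasible → ¬ ∃ x, D.IsFeasible x) ∧
      -- a returned first-stage decision is optimal, and the returned value is the optimal value
      (∀ k x v, D.Execution st₀ k (.done x v) →
        D.IsOptimal x ∧ D.objective x = v ∧ D.optimalValue = v ∧ ∃ w : ℝ, v = (w : EReal)) ∧
      -- an execution can be infinite only by staying forever in one correction phase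
      (∀ c : ℕ → NestedCCG.Config nx mx my ky, c 0 = .outer st₀ →
        (∀ n, D.Step (c n) (c (n + 1))) →
        ∃ n₀ st x, (∀ n ≥ n₀, ∃ S, c n = .isfPhase2 st x S) ∨
          ∃ l v, ∀ n ≥ n₀, ∃ S, c n = .isoPhase2 st x S l v) ∧
      -- an execution that cannot be continued has terminated, unless it has arrived at a feasible
      -- outer master problem, or at an inner master problem for optimality, without an optimal
      -- solution
      (∀ k c, D.Execution st₀ k c → (∀ c', ¬ D.Step c c') →
        c = .infeasible ∨ (∃ x v, c = .done x v) ∨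
        (∃ st, c = .outer st ∧ (∃ x e, D.OMPFeasible st.pool x e) ∧
          ¬ ∃ x w, D.IsOMPSolution st.pool x w) ∨
        (∃ st x Y l, c = .isoPhase1 st x Y l ∧ ¬ ∃ u, D.AttainsIMPo x Y u)) := by
  have hinv := fun {st₀} (h₀ : D.IsInitial st₀) {k c} (h : D.Execution st₀ k c) =>
    h.inv hA1 hA2 hA3 h₀
  -- `D.cuts` does not involve the initial pool, so the bound is uniform; the extra one counts the
  -- last iteration, which need not add a new set.
  refine ⟨⟨D.cuts.ncard + 1, fun st₀ h₀ k c h => (hinv h₀ h).2.le (hinv h₀ h).1⟩,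
    fun st₀ h₀ => ⟨fun k st x S h => (hinv h₀ h).1.2.2, fun k st x S v h hS c' hs => ?_,
      fun k h => (hinv h₀ h).1, fun k x v h => (hinv h₀ h).1, fun c hc hs => ?_,
      fun k c h hstuck => (hinv h₀ h).1.terminated_of_stuck hY hA1 hA2 hA3 hstuck⟩⟩
  · cases hs with
    | opt_stop _ _ _ _ x' _ _ => exact ⟨x', _, rfl⟩
    | opt_continue _ _ _ _ hbd =>
      exact absurd (NestedCCG.TwoStageRO.ub_updateOpt_le_lb (hinv h₀ h).1 hS) hbd
  · refine NestedCCG.TwoStageRO.eventually_samePhase hA1 (fun n => ?_) hs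
    obtain ⟨k, hk⟩ := NestedCCG.TwoStageRO.exists_execution hc hs n
    exact (hinv h₀ hk).1
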